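/- Let $d\ge 1$. For $\boldsymbol\theta=(\theta_1,\dots,\theta_d):[0,1]\to\mathbb R^d$ and $\sigma:[0,1]\to[0,\infty)$ and for each $n\ge 1$, consider the time-varying autoregression $$X_{k,n}=\sum_{i=1}^d\theta_i((k-1)/n)\,X_{k-i,n}+\sigma(k/n)\,\varepsilon_{k,n},\qquad 1\le k\le n,$$ and put $\mathbf X_{k,n}=[X_{k,n},X_{k-1,n},\dots,X_{k-d+1,n}]^T$ for $0\le k\le n$, where $\mathbf X_{0,n}$ is the given random initial condition. Let $|\cdot|$ be the Euclidean norm on $\mathbb R^d$ and the associated operator norm on $d\times d$ matrices, and $\|\mathbf Z\|_p=(\mathbb E|\mathbf Z|^p)^{1/p}$. For $\nu\ge 0$ and $\mathbf x\in\mathbb R^d$ let $F_\nu(\mathbf x)=\mathbf x\mathbf x^T/(1+\nu|\mathbf x|^2)$, and for $\mu\ge0$ and $0\le j\le k\le n$ let $$\Psi_n(k,j;\mu)=(I-\mu F_\mu(\mathbf X_{k,n}))(I-\mu F_\mu(\mathbf X_{k-1,n}))\cdots(I-\mu F_\mu(\mathbf X_{j+1,n})),\qquad \Psi_n(j,j;\mu)=I.$$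 For $\beta\in(0,1]$, $L>0$, $0<\rho<1$ and $0<\sigma_-\le\sigma_+$, let $\mathcal C(\beta,L,\rho,\sigma_-,\sigma_+)$ be the set of pairs $(\boldsymbol\theta,\sigma)$ such that $|\boldsymbol\theta(t)|\le L$ and $|\boldsymbol\theta(t)-\boldsymbol\theta(s)|\le L|t-s|^\beta$ for all $s,t\in[0,1]$, such that $1-\sum_{j=1}^d\theta_j(t)z^j\ne0$ for all $t\in[0,1]$ and all $z\in\mathbb C$ with $|z|<\rho^{-1}$, and such that $\sigma$ takes values in $[\sigma_-,\sigma_+]$. Theorem. Let $q\ge4$ be real and assume (A1): for every $n\ge1$ the random variables $\varepsilon_{k,n}$, $1\le k\le n$, are independent, have mean zero and unit variance, and are (jointly) independent of $\mathbf X_{0,n}$; moreover $\sup_{n\ge1}\|\mathbf X_{0,n}\|_q<\infty$ and $\sup_{1\le k\le n}\|\varepsilon_{k,n}\|_q<\infty$, the latter supremum being over all $n\ge 1$ and $1\le k\le n$. Let $\beta\in(0,1]$, $L>0$, $0<\rho<1$ and $0<\sigma_-\le\sigma_+$. Then for every real $p\ge1$ there exist $M>0$, $\delta>0$ and $\mu_0>0$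 such that, for all $n\ge1$, all $0\le j\le k\le n$, all $\mu\in[0,\mu_0]$ and all $(\boldsymbol\theta,\sigma)\in\mathcal C(\beta,L,\rho,\sigma_-,\sigma_+)$, $$\|\Psi_n(k,j;\mu)\|_p\le M(1-\delta\mu)^{k-j}.$$ -/

import Mathlib

open MeasureTheory ProbabilityTheory
-- The norm on matrices is the operator norm associated with the Euclidean norm.
open scoped Matrix.Norms.L2Operator

namespace TVAR

/-- The `d`-dimensional Euclidean space. -/
abbrev Vec (d : ℕ) : Type := EuclideanSpace ℝ (Fin d)

/-- The `β`-Lipschitz ball of maps `[0, 1] → ℝ^d`, `0 < β ≤ 1`. Functions on `[0, 1]` are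
represented by functions on `ℝ`, of which only the values on `[0, 1]` matter. -/
def LipBall (d : ℕ) (β L : ℝ) : Set (ℝ → Vec d) :=
  {f | (∀ t ∈ Set.Icc (0 : ℝ) 1, ∀ s ∈ Set.Icc (0 : ℝ) 1, ‖f t - f s‖ ≤ L * |t - s| ^ β) ∧
    ∀ t ∈ Set.Icc (0 : ℝ) 1, ‖f t‖ ≤ L}

/-- The local autoregressive polynomial `θ(z; t) = 1 - ∑_{j=1}^d θ_j(t) z^j`. -/
noncomputable def arPoly {d : ℕ} (θ : ℝ → Vec d) (t : ℝ) (z : ℂ) : ℂ :=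
  1 - ∑ j : Fin d, ((θ t j : ℝ) : ℂ) * z ^ (j.val + 1)

/-- The set `S(ρ)`: the local autoregressive polynomials have no zero in `|z| < ρ⁻¹`. -/
def StableSet (d : ℕ) (ρ : ℝ) : Set (ℝ → Vec d) :=
  {θ | ∀ z : ℂ, ‖z‖ < ρ⁻¹ → ∀ t ∈ Set.Icc (0 : ℝ) 1, arPoly θ t z ≠ 0}

/-- The parameter class `C(β, L, ρ, σ₋, σ₊)`. -/
def ParamClass (d : ℕ) (β L ρ σm σp : ℝ) : Set ((ℝ → Vec d) × (ℝ → ℝ)) :=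
  {c | c.1 ∈ LipBall d β L ∩ StableSet d ρ ∧ ∀ t ∈ Set.Icc (0 : ℝ) 1, c.2 t ∈ Set.Icc σm σp}

/-- The lag vector `𝐗_{k,n} = (X_{k,n}, X_{k-1,n}, …, X_{k-d+1,n})` of the time-varying
autoregression `X_{k,n} = ∑_{i=1}^d θ_i((k-1)/n) X_{k-i,n} + σ(k/n) ε_{k,n}`, as a function of the
initial lag vector `x₀ = 𝐗_{0,n}` and of the innovations `e k = ε_{k,n}`. -/
noncomputable def lagVec {d : ℕ} (n : ℕ) (θ : ℝ → Vec d) (σ : ℝ → ℝ) (x₀ : Vec d) (e : ℕ → ℝ) :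
    ℕ → Vec d
  | 0 => x₀
  | k + 1 => WithLp.toLp 2 fun i : Fin d =>
      if i.val = 0 then
        (∑ j : Fin d, θ ((k : ℝ) / n) j * lagVec n θ σ x₀ e k j)
          + σ (((k + 1 : ℕ) : ℝ) / n) * e (k + 1)
      else lagVec n θ σ x₀ e k ⟨i.val - 1, by omega⟩

/-- `F_ν(x) = x xᵀ / (1 + ν |x|²)`. -/
noncomputable def F {d : ℕ} (ν : ℝ) (x : Vec d) : Matrix (Fin d) (Fin d) ℝ :=
  (1 + ν * ‖x‖ ^ 2)⁻¹ • Matrix.vecMulVec x x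

/-- For a sequence of vectors `x`, the ordered product
`(I - μ F_μ(x_k)) (I - μ F_μ(x_{k-1})) ⋯ (I - μ F_μ(x_{j+1}))`, which is `I` for `k ≤ j`. -/
noncomputable def matProd {d : ℕ} (μ : ℝ) (x : ℕ → Vec d) (j : ℕ) :
    ℕ → Matrix (Fin d) (Fin d) ℝ
  | 0 => 1
  | k + 1 => if j ≤ k then (1 - μ • F μ (x (k + 1))) * matProd μ x j k else 1

/-- The random matrix `Ψ_n(k, j; μ)`; here `X₀` is the initial lag vector and `ε k` the `k`-th
innovation of the `n`-th row. -/
noncomputable def Psi {d : ℕ} {Ω : Type*} (n : ℕ) (θ : ℝ → Vec d) (σ : ℝ → ℝ) (X₀ : Ω → Vec d)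
    (ε : ℕ → Ω → ℝ) (k j : ℕ) (μ : ℝ) (ω : Ω) : Matrix (Fin d) (Fin d) ℝ :=
  matProd μ (lagVec n θ σ (X₀ ω) fun i => ε i ω) j k

/-- Assumption (A1) with moment order `q`, for the rows `n ≥ 1` of innovations
`ε n k`, `1 ≤ k ≤ n`, and initial lag vectors `X₀ n`; each row may live on its own space. -/
structure A1 {d : ℕ} {Ω : ℕ → Type*} [∀ n, MeasurableSpace (Ω n)] (P : ∀ n, Measure (Ω n))
    (X₀ : ∀ n, Ω n → Vec d) (ε : ∀ n, ℕ → Ω n → ℝ) (q : ℝ) : Prop where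
  measurable_init : ∀ n, 1 ≤ n → Measurable (X₀ n)
  measurable_innov : ∀ n, ∀ k ∈ Set.Icc 1 n, Measurable (ε n k)
  indep : ∀ n, 1 ≤ n → iIndepFun (fun k : Set.Icc 1 n => ε n k) (P n)
  indep_init : ∀ n, 1 ≤ n → IndepFun (fun ω => fun k : Set.Icc 1 n => ε n k ω) (X₀ n) (P n)
  mean_zero : ∀ n, ∀ k ∈ Set.Icc 1 n, ∫ ω, ε n k ω ∂(P n) = 0
  unit_variance : ∀ n, ∀ k ∈ Set.Icc 1 n, variance (ε n k) (P n) = 1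
  init_bound : ⨆ n : ℕ, ⨆ _ : 1 ≤ n, eLpNorm (X₀ n) (ENNReal.ofReal q) (P n) < ⊤
  innov_bound :
    ⨆ n : ℕ, ⨆ k : ℕ, ⨆ _ : k ∈ Set.Icc 1 n, eLpNorm (ε n k) (ENNReal.ofReal q) (P n) < ⊤

end TVAR

/-!
The product `Ψ(k, j; μ)` is studied through its action on a fixed vector: `w_l = Ψ(l, j; μ) u`
satisfies `w_{l+1} = (I - μ F_μ(X_{l+1})) w_l`, where the factors have norm at most one. Hence
`|Ψ| ≤ 1`, all moments are controlled by the second one, and the second one by `E|w_k|²` for `u` in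
the canonical basis. It remains to show that `E|w_k|²` decays geometrically at a rate of order `μ`.

This is done on blocks of a fixed length `r ≥ d`, with the Lyapunov function
`W (1 + a μ V)`, `W = |w|²`, `V = |X|²` (`integral_lyapunov_le`). Two mechanisms compete.

* Excitation. Over a block `W` loses at least a multiple of `μ ⟨w_i, X_{i+r}⟩² / (1 + μ |X_{i+r}|²)`,
  for each outcome (`excitation_le`). Given the past, `⟨w_i, X_{i+r}⟩` has a first absolute moment of
  order `|w_i|`, because the innovations reach all directions within `d` steps
  (`IsLagProcess.integral_norm_le_integral_inner`); this is where a moment of order higher than two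
  enters, through a lower bound for `E|ε|` (`le_integral_abs_of_fourth_moment`). The gain is thus of
  order `μ W / (1 + μ V)`, which degenerates when `V` is large.
* Drift. The conditional expectation of `V` after a block is at most `V / 2 + B`
  (`IsLagProcess.integral_mul_norm_sq_le`), which gives the decay when `V` is large. It rests on the
  contraction of the noiseless recursion over a block (`exists_flow_contraction`): the frozen
  recursions are exponentially stable uniformly over the class (`exists_companion_pow_bound`), and for
  `n` large the Hölder condition makes the coefficients nearly constant over a block. For the
  remaining values of `n` the product has a bounded number of factors and the claim is trivial.

Conditioning on the past is expressed by weights that are measurable for the past σ-algebra.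
-/

namespace TVAR

open scoped InnerProductSpace

/-! ### Linear recurrences -/

/-- The shift `(x_k)_k ↦ (x_{k+1})_k` on complex sequences. -/
noncomputable def seqShift : Module.End ℂ (ℕ → ℂ) where
  toFun x := fun k => x (k + 1)
  map_add' _ _ := rfl
  map_smul' _ _ := rfl

lemma seqShift_pow_apply (m : ℕ) (x : ℕ → ℂ) (k : ℕ) : (seqShift ^ m) x k = x (k + m) := by
  induction m generalizing k with
  | zero => simp
  | succ m ih =>
    rw [pow_succ', Module.End.mul_apply]
    change (seqShift ^ m) x (k + 1) = _
    rw [ih]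
    congr 1
    ring

open Polynomial in
/-- A sequence annihilated by a product of `N` operators `x ↦ (x_{k+1} - r x_k)_k` with `|r| ≤ ρ`
grows at most like `ρ'^k` for any `ρ' > ρ`, uniformly in the numbers `r`. Peeling off one factor
leaves a first-order recursion with an exponentially small right-hand side. -/
lemma exists_bound_of_prod_roots {ρ ρ' : ℝ} (hρ : 0 ≤ ρ) (hρ1 : ρ ≤ 1) (hρρ' : ρ < ρ') (N : ℕ) :
    ∃ K : ℝ, 0 ≤ K ∧ ∀ s : Multiset ℂ, s.card = N → (∀ r ∈ s, ‖r‖ ≤ ρ) →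
      ∀ (x : ℕ → ℂ) (B : ℝ), 0 ≤ B → aeval seqShift (s.map fun r => X - C r).prod x = 0 →
        (∀ j < N, ‖x j‖ ≤ B) → ∀ m, ‖x m‖ ≤ K * B * ρ' ^ m := by
  have hρ'0 : 0 < ρ' := hρ.trans_lt hρρ'
  induction N with
  | zero =>
    refine ⟨0, le_rfl, fun s hs _ x B hB hx _ m => ?_⟩
    rw [Multiset.card_eq_zero] at hs
    subst hs
    rw [Multiset.map_zero, Multiset.prod_zero, map_one, Module.End.one_apply] at hx
    simp [hx]
  | succ N ih =>
    obtain ⟨C₀, hC₀, h⟩ := ih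
    have hgap : 0 < ρ' - ρ := sub_pos.2 hρρ'
    refine ⟨1 + 2 * C₀ / (ρ' - ρ), by positivity, fun s hs hr x B hB hx hxB => ?_⟩
    obtain ⟨r, s', rfl⟩ : ∃ r s', s = r ::ₘ s' := by
      obtain ⟨r, hrs⟩ := Multiset.card_pos_iff_exists_mem.1 (by rw [hs]; omega : 0 < s.card)
      exact ⟨r, _, (Multiset.cons_erase hrs).symm⟩
    have hrρ : ‖r‖ ≤ ρ := hr r (Multiset.mem_cons_self _ _)
    set y : ℕ → ℂ := fun k => x (k + 1) - r * x k with hy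
    have hyx : aeval seqShift (X - C r : ℂ[X]) x = y := by
      funext k
      simp [hy, seqShift, Algebra.algebraMap_eq_smul_one]
    have hy0 : aeval seqShift (s'.map fun r => X - C r).prod y = 0 := by
      rw [← hyx, ← Module.End.mul_apply, ← map_mul, mul_comm, ← Multiset.prod_cons,
        ← Multiset.map_cons (fun r => (X - C r : ℂ[X]))]
      exact hx
    have hyB : ∀ j < N, ‖y j‖ ≤ 2 * B := by
      intro j hj
      calc ‖y j‖ ≤ ‖x (j + 1)‖ + ‖r * x j‖ := norm_sub_le _ _
        _ ≤ B + 1 * B := by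
            rw [norm_mul]
            gcongr
            · exact hxB _ (by omega)
            · exact hrρ.trans hρ1
            · exact hxB _ (by omega)
        _ = 2 * B := by ring
    have hym := h s' (by simpa using hs) (fun r' h' => hr r' (Multiset.mem_cons_of_mem h')) y
      (2 * B) (by positivity) hy0 hyB
    set K : ℝ := 1 + 2 * C₀ / (ρ' - ρ) with hK
    have hKgap : 2 * C₀ ≤ K * (ρ' - ρ) := by
      rw [hK, add_mul, div_mul_cancel₀ _ hgap.ne']
      linarith
    intro m
    induction m with
    | zero =>
      have h1 : (1 : ℝ) ≤ K := by rw [hK]; linarith [div_nonneg (mul_nonneg zero_le_two hC₀) hgap.le]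
      have := hxB 0 (by omega)
      nlinarith
    | succ m ihm =>
      have hxm : x (m + 1) = r * x m + y m := by simp [hy]
      calc ‖x (m + 1)‖ ≤ ‖r‖ * ‖x m‖ + ‖y m‖ := by
            rw [hxm, ← norm_mul]; exact norm_add_le _ _
        _ ≤ ρ * (K * B * ρ' ^ m) + C₀ * (2 * B) * ρ' ^ m := by
            gcongr
            exact hym m
        _ = (ρ * K + 2 * C₀) * (B * ρ' ^ m) := by ring
        _ ≤ (ρ' * K) * (B * ρ' ^ m) := by
            gcongr
            linarith
        _ = K * B * ρ' ^ (m + 1) := by ring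

variable {d : ℕ}

/-! ### Companion maps -/

lemma norm_le_sum_abs (x : Vec d) : ‖x‖ ≤ ∑ i, |x i| := by
  rw [EuclideanSpace.norm_eq]
  refine Real.sqrt_le_iff.2 ⟨Finset.sum_nonneg fun i _ => abs_nonneg _, ?_⟩
  simpa using Finset.sum_sq_le_sq_sum_of_nonneg (s := Finset.univ) (f := fun i => |x i|)
    (fun i _ => abs_nonneg _)

lemma abs_apply_le_norm (x : Vec d) (i : Fin d) : |x i| ≤ ‖x‖ := by
  simpa using PiLp.norm_apply_le x i

/-- The vector `(1, 0, …, 0)`, along which the innovations enter the lag vector. -/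
noncomputable def firstVec (d : ℕ) : Vec d := WithLp.toLp 2 fun i => if i.val = 0 then 1 else 0

/-- The companion map `x ↦ (∑ a_j x_j, x_0, …, x_{d-2})` of the autoregression with
coefficients `a`. -/
noncomputable def companion (a : Vec d) : Vec d →ₗ[ℝ] Vec d where
  toFun x := WithLp.toLp 2 fun i : Fin d =>
    if i.val = 0 then ∑ j : Fin d, a j * x j else x ⟨i.val - 1, by omega⟩
  map_add' x y := by
    ext i
    by_cases hi : i.val = 0 <;> simp [hi, mul_add, Finset.sum_add_distrib]
  map_smul' c x := by
    ext i
    by_cases hi : i.val = 0 <;> simp [hi, Finset.mul_sum, mul_left_comm]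

lemma companion_apply (a x : Vec d) (i : Fin d) : companion a x i =
    if i.val = 0 then ∑ j : Fin d, a j * x j else x ⟨i.val - 1, by omega⟩ := rfl

lemma lagVec_succ (n : ℕ) (θ : ℝ → Vec d) (σ : ℝ → ℝ) (x₀ : Vec d) (e : ℕ → ℝ) (k : ℕ) :
    lagVec n θ σ x₀ e (k + 1) = companion (θ ((k : ℝ) / n)) (lagVec n θ σ x₀ e k)
      + (σ (((k + 1 : ℕ) : ℝ) / n) * e (k + 1)) • firstVec d := by
  ext i
  by_cases hi : i.val = 0 <;> simp [hi, lagVec, companion_apply, firstVec]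

lemma norm_firstVec_le (d : ℕ) : ‖firstVec d‖ ≤ 1 := by
  rw [EuclideanSpace.norm_eq]
  refine Real.sqrt_le_one.2 ?_
  cases d with
  | zero => simp
  | succ d => simp [firstVec]

lemma abs_sum_mul_le (a x : Vec d) : |∑ j, a j * x j| ≤ ‖a‖ * ‖x‖ := by
  have := abs_real_inner_le_norm a x
  rwa [PiLp.inner_apply, show (∑ i, inner ℝ (a i) (x i)) = ∑ j, a j * x j from
    Finset.sum_congr rfl fun i _ => by simp [mul_comm]] at this

lemma norm_companion_le (a x : Vec d) : ‖companion a x‖ ≤ d * (1 + ‖a‖) * ‖x‖ := by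
  calc ‖companion a x‖ ≤ ∑ i, |companion a x i| := norm_le_sum_abs _
    _ ≤ ∑ _i : Fin d, (1 + ‖a‖) * ‖x‖ := by
        refine Finset.sum_le_sum fun i _ => ?_
        rw [companion_apply]
        split_ifs
        · have := abs_sum_mul_le a x
          nlinarith [norm_nonneg x, norm_nonneg a]
        · have := abs_apply_le_norm x ⟨i.val - 1, by omega⟩
          nlinarith [norm_nonneg x, norm_nonneg a, mul_nonneg (norm_nonneg a) (norm_nonneg x)]
    _ = d * (1 + ‖a‖) * ‖x‖ := by simp [mul_assoc]

lemma norm_companion_sub_le (a b x : Vec d) :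
    ‖companion a x - companion b x‖ ≤ ‖a - b‖ * ‖x‖ := by
  have h : companion a x - companion b x = (∑ j, (a - b) j * x j) • firstVec d := by
    ext i
    by_cases hi : i.val = 0 <;>
      simp [hi, companion_apply, firstVec, sub_mul, Finset.sum_sub_distrib]
  rw [h, norm_smul]
  calc _ ≤ ‖a - b‖ * ‖x‖ * 1 := by
        gcongr
        · exact abs_sum_mul_le _ _
        · exact norm_firstVec_le d
    _ = _ := mul_one _

lemma companion_pow_apply_add (a x : Vec d) (k t : ℕ) (i : Fin d) (h : i.val + t < d) :
    (companion a ^ (k + t)) x ⟨i.val + t, h⟩ = (companion a ^ k) x i := by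
  induction t with
  | zero => simp
  | succ t ih =>
    have h0 : ¬ (⟨i.val + (t + 1), h⟩ : Fin d).val = 0 := by simp
    rw [← ih (by omega), show k + (t + 1) = (k + t) + 1 from rfl, pow_succ',
      Module.End.mul_apply, companion_apply, if_neg h0]
    rfl

/-! ### Stability of the frozen autoregressions -/

open Polynomial in
/-- Uniform exponential stability of the frozen autoregressions: the zeros of the characteristic
polynomial lie in the disc of radius `ρ`, and a sequence solving the recurrence is annihilated by
the corresponding product of first-order difference operators. -/
lemma exists_companion_pow_bound (hd : 1 ≤ d) {ρ : ℝ} (hρ : ρ ∈ Set.Ioo (0 : ℝ) 1) :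
    ∃ C : ℝ, 0 ≤ C ∧ ∀ a : Vec d,
      (∀ z : ℂ, ‖z‖ < ρ⁻¹ → 1 - ∑ j : Fin d, ((a j : ℝ) : ℂ) * z ^ (j.val + 1) ≠ 0) →
      ∀ (x : Vec d) (m : ℕ), ‖(companion a ^ m) x‖ ≤ C * ((1 + ρ) / 2) ^ m * ‖x‖ := by
  obtain ⟨hρ0, hρ1⟩ := hρ
  obtain ⟨C₀, hC₀, hbound⟩ := exists_bound_of_prod_roots hρ0.le hρ1.le
    (by linarith : ρ < (1 + ρ) / 2) d
  refine ⟨d * C₀, by positivity, fun a ha x m => ?_⟩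
  set ρ' := (1 + ρ) / 2 with hρ'
  have hρ'0 : 0 < ρ' := by positivity
  have hρ'1 : ρ' ≤ 1 := by rw [hρ']; linarith
  set u : ℕ → ℂ := fun k => (((companion a ^ k) x ⟨d - 1, by omega⟩ : ℝ) : ℂ) with hu
  -- the coordinates of the iterates are the terms of one scalar sequence
  have hcoord : ∀ (k : ℕ) (i : Fin d), (((companion a ^ k) x i : ℝ) : ℂ) = u (k + (d - 1 - i)) := by
    intro k i
    have hi : (⟨d - 1, by omega⟩ : Fin d) = ⟨i + (d - 1 - i), by omega⟩ :=
      Fin.ext (by simp only; omega)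
    rw [hu, ← companion_pow_apply_add a x k (d - 1 - i) i (by omega)]
    simp only [hi]
  set f : ℂ[X] := X ^ d - ∑ j : Fin d, C ((a j : ℝ) : ℂ) * X ^ (d - 1 - j.val) with hf
  have hfm : f.Monic := by
    refine monic_X_pow_sub ?_
    refine (degree_sum_le _ _).trans_lt ?_
    refine (Finset.sup_lt_iff (WithBot.bot_lt_coe d)).2 fun j _ => ?_
    refine (degree_C_mul_X_pow_le _ _).trans_lt ?_
    exact Nat.cast_lt.2 (by omega : d - 1 - j.val < d)
  have hdeg : f.natDegree = d := by
    rw [hf, natDegree_sub_eq_left_of_natDegree_lt, natDegree_X_pow]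
    rw [natDegree_X_pow]
    refine (natDegree_sum_le_of_forall_le _ _ (n := d - 1) fun j _ => ?_).trans_lt (by omega)
    exact (natDegree_C_mul_X_pow_le _ _).trans (by omega)
  have hsplit : f = (f.roots.map fun r => X - C r).prod :=
    ((IsAlgClosed.splits f).eq_prod_roots_of_monic hfm)
  have hcard : f.roots.card = d := by
    rw [← (IsAlgClosed.splits f).natDegree_eq_card_roots, hdeg]
  have hroots : ∀ r ∈ f.roots, ‖r‖ ≤ ρ := by
    intro r hr
    have hr0 : f.eval r = 0 := (mem_roots'.1 hr).2
    by_contra! hlt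
    have hrne : r ≠ 0 := by
      rintro rfl
      simp at hlt
      linarith
    refine ha r⁻¹ ?_ ?_
    · rw [norm_inv]
      exact (inv_lt_inv₀ (by linarith) hρ0).2 hlt
    · have h1 : r ^ d * (1 - ∑ j : Fin d, ((a j : ℝ) : ℂ) * r⁻¹ ^ (j.val + 1)) = f.eval r := by
        rw [hf, mul_sub, mul_one, Finset.mul_sum]
        simp only [eval_sub, eval_pow, eval_X, eval_finsetSum, eval_mul, eval_C]
        congr 1
        refine Finset.sum_congr rfl fun j _ => ?_
        have : r ^ d = r ^ (d - 1 - j.val) * r ^ (j.val + 1) := by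
          rw [← pow_add]; congr 1; omega
        rw [this, inv_pow]
        field_simp
      rw [hr0] at h1
      exact (mul_eq_zero.1 h1).resolve_left (pow_ne_zero _ hrne)
  have hrec : aeval seqShift f u = 0 := by
    funext k
    have h1 : u (k + d) = ∑ j : Fin d, ((a j : ℝ) : ℂ) * u (k + (d - 1 - j)) := by
      have h2 := hcoord (k + 1) ⟨0, by omega⟩
      rw [show k + 1 + (d - 1 - 0) = k + d by omega] at h2
      rw [← h2, pow_succ', Module.End.mul_apply, companion_apply, if_pos rfl]
      push_cast
      exact Finset.sum_congr rfl fun j _ => by rw [hcoord]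
    rw [hf]
    simp only [map_sub, map_pow, aeval_X, map_sum, map_mul, aeval_C, LinearMap.sub_apply,
      LinearMap.sum_apply, Module.End.mul_apply, Pi.sub_apply, Finset.sum_apply, Pi.zero_apply,
      seqShift_pow_apply, Module.algebraMap_end_apply, Pi.smul_apply, smul_eq_mul]
    rw [h1, sub_self]
  have hinit : ∀ j < d, ‖u j‖ ≤ ‖x‖ := by
    intro j hj
    have := hcoord 0 ⟨d - 1 - j, by omega⟩
    rw [show 0 + (d - 1 - (d - 1 - j)) = j by omega] at this
    rw [← this, Complex.norm_real]
    exact abs_apply_le_norm _ _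
  have hub := hbound f.roots hcard hroots u ‖x‖ (norm_nonneg _) (by rw [← hsplit]; exact hrec) hinit
  calc ‖(companion a ^ m) x‖ ≤ ∑ i, |(companion a ^ m) x i| := norm_le_sum_abs _
    _ ≤ ∑ _i : Fin d, C₀ * ‖x‖ * ρ' ^ m := by
        refine Finset.sum_le_sum fun i _ => ?_
        have h1 : |(companion a ^ m) x i| = ‖u (m + (d - 1 - i))‖ := by
          rw [← hcoord, Complex.norm_real, Real.norm_eq_abs]
        rw [h1]
        refine (hub _).trans ?_
        gcongr ?_ * ?_
        exact pow_le_pow_of_le_one hρ'0.le hρ'1 (by omega)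
    _ = d * C₀ * ρ' ^ m * ‖x‖ := by simp; ring

/-! ### Controllability of the companion form -/

lemma inner_firstVec (hd : 1 ≤ d) (u : Vec d) : ⟪u, firstVec d⟫_ℝ = u ⟨0, hd⟩ := by
  have h : firstVec d = EuclideanSpace.single ⟨0, hd⟩ 1 := by
    ext i
    simp [firstVec, Fin.ext_iff]
  rw [h, EuclideanSpace.inner_single_right]
  simp

lemma adjoint_companion_apply (hd : 1 ≤ d) (a u : Vec d) (j : Fin d) (hj : j.val + 1 < d) :
    LinearMap.adjoint (companion a) u j = a j * u ⟨0, hd⟩ + u ⟨j.val + 1, hj⟩ := by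
  have h : companion a (EuclideanSpace.single j 1)
      = a j • firstVec d + EuclideanSpace.single ⟨j.val + 1, hj⟩ 1 := by
    ext i
    by_cases hi : i.val = 0
    · have : i ≠ ⟨j.val + 1, hj⟩ := fun h => by simp [h] at hi
      simp [companion_apply, firstVec, hi, this]
    · have : ((⟨i.val - 1, by omega⟩ : Fin d) = j) ↔ (i = ⟨j.val + 1, hj⟩) := by
        simp only [Fin.ext_iff]; omega
      simp [companion_apply, firstVec, hi, this]
  have h1 : LinearMap.adjoint (companion a) u j
      = ⟪EuclideanSpace.single j (1 : ℝ), LinearMap.adjoint (companion a) u⟫_ℝ := by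
    rw [EuclideanSpace.inner_single_left]; simp
  rw [h1, LinearMap.adjoint_inner_right, h, inner_add_left, real_inner_smul_left,
    real_inner_comm, inner_firstVec hd, EuclideanSpace.inner_single_left]
  simp

/-- Controllability of the companion form: a vector is determined by the first coordinates of its
iterates under the transposed companion maps. -/
lemma abs_apply_le_sum_adjoint (hd : 1 ≤ d) {L : ℝ} (j : ℕ) (hj : j < d) :
    ∀ (u b : ℕ → Vec d), (∀ m, m < d → ‖b m‖ ≤ L) →
      (∀ m, u (m + 1) = LinearMap.adjoint (companion (b m)) (u m)) →
      |u 0 ⟨j, hj⟩| ≤ (1 + L) * ∑ m ∈ Finset.range (j + 1), |u m ⟨0, hd⟩| := by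
  suffices H : ∀ (u b : ℕ → Vec d), (∀ m, m < j → ‖b m‖ ≤ L) → 0 ≤ L →
      (∀ m, u (m + 1) = LinearMap.adjoint (companion (b m)) (u m)) →
      |u 0 ⟨j, hj⟩| ≤ (1 + L) * ∑ m ∈ Finset.range (j + 1), |u m ⟨0, hd⟩| from
    fun u b hb hu => H u b (fun m hm => hb m (hm.trans hj))
      ((norm_nonneg _).trans (hb 0 hd)) hu
  induction j with
  | zero =>
    intro u b _ hL hu
    simp only [zero_add, Finset.range_one, Finset.sum_singleton]
    nlinarith [abs_nonneg (u 0 ⟨0, hd⟩)]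
  | succ j ih =>
    intro u b hb hL hu
    have h1 := ih (by omega) (fun m => u (m + 1)) (fun m => b (m + 1))
      (fun m hm => hb _ (by omega)) hL (fun m => hu _)
    have h2 := adjoint_companion_apply hd (b 0) (u 0) ⟨j, by omega⟩ hj
    rw [← hu 0] at h2
    have h3 : |b 0 ⟨j, by omega⟩| ≤ L := (abs_apply_le_norm _ _).trans (hb 0 (by omega))
    have h4 : u 0 ⟨j + 1, hj⟩ = u (0 + 1) ⟨j, by omega⟩ - b 0 ⟨j, by omega⟩ * u 0 ⟨0, hd⟩ := by
      rw [h2]; simp only; ring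
    rw [Finset.sum_range_succ', h4]
    refine (abs_sub _ _).trans ?_
    rw [abs_mul]
    have h5 : |b 0 ⟨j, by omega⟩| * |u 0 ⟨0, hd⟩| ≤ L * |u 0 ⟨0, hd⟩| := by gcongr
    simp only at h1
    linarith [abs_nonneg (u 0 ⟨0, hd⟩)]

lemma norm_le_sum_adjoint (hd : 1 ≤ d) {L : ℝ} (u b : ℕ → Vec d) (hb : ∀ m, m < d → ‖b m‖ ≤ L)
    (hu : ∀ m, u (m + 1) = LinearMap.adjoint (companion (b m)) (u m)) :
    ‖u 0‖ ≤ d * (1 + L) * ∑ m ∈ Finset.range d, |u m ⟨0, hd⟩| := by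
  have hL : 0 ≤ L := (norm_nonneg _).trans (hb 0 hd)
  calc ‖u 0‖ ≤ ∑ i, |u 0 i| := norm_le_sum_abs _
    _ ≤ ∑ _i : Fin d, (1 + L) * ∑ m ∈ Finset.range d, |u m ⟨0, hd⟩| := by
        refine Finset.sum_le_sum fun i _ => ?_
        refine (abs_apply_le_sum_adjoint hd i.val i.isLt u b hb hu).trans ?_
        gcongr
        omega
    _ = _ := by simp [mul_assoc]

/-! ### The noiseless flow over a block -/

/-- The noiseless flow over `t` steps from time `i`, for the coefficient sequence `a`. -/
noncomputable def flow (a : ℕ → Vec d) (i : ℕ) : ℕ → Vec d →ₗ[ℝ] Vec d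
  | 0 => LinearMap.id
  | t + 1 => companion (a (i + t)) ∘ₗ flow a i t

lemma flow_succ (a : ℕ → Vec d) (i t : ℕ) (x : Vec d) :
    flow a i (t + 1) x = companion (a (i + t)) (flow a i t x) := rfl

lemma norm_flow_le {a : ℕ → Vec d} {i t : ℕ} {K : ℝ} (hK : 0 ≤ K)
    (ha : ∀ s < t, ∀ x, ‖companion (a (i + s)) x‖ ≤ K * ‖x‖) (x : Vec d) :
    ‖flow a i t x‖ ≤ K ^ t * ‖x‖ := by
  induction t with
  | zero => simp [flow]
  | succ t ih =>
    rw [flow_succ]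
    refine (ha t (by omega) _).trans ?_
    rw [pow_succ', mul_assoc]
    exact mul_le_mul_of_nonneg_left (ih fun s hs => ha s (by omega)) hK

lemma norm_flow_sub_pow_le {a : ℕ → Vec d} {i t : ℕ} {K η : ℝ} (hK : 1 ≤ K) (hη : 0 ≤ η)
    (ha : ∀ s ≤ t, ∀ x, ‖companion (a (i + s)) x‖ ≤ K * ‖x‖)
    (hη' : ∀ s < t, ‖a (i + s) - a i‖ ≤ η) (x : Vec d) :
    ‖flow a i t x - (companion (a i) ^ t) x‖ ≤ t * K ^ t * η * ‖x‖ := by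
  induction t with
  | zero => simp [flow]
  | succ t ih =>
    have h0 : 0 ≤ K := by linarith
    have h1 := ih (fun s hs => ha s (by omega)) (fun s hs => hη' s (by omega))
    have h2 := norm_flow_le h0 (fun s hs => ha s (by omega) : ∀ s < t, _) x
    rw [flow_succ, pow_succ', Module.End.mul_apply]
    calc ‖companion (a (i + t)) (flow a i t x) - companion (a i) ((companion (a i) ^ t) x)‖
        = ‖(companion (a (i + t)) (flow a i t x) - companion (a i) (flow a i t x))
          + companion (a i) (flow a i t x - (companion (a i) ^ t) x)‖ := by
          rw [map_sub]; congr 1; abel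
      _ ≤ η * (K ^ t * ‖x‖) + K * (t * K ^ t * η * ‖x‖) := by
          refine (norm_add_le _ _).trans (add_le_add ?_ ?_)
          · refine (norm_companion_sub_le _ _ _).trans ?_
            gcongr
            exact hη' t (by omega)
          · refine (ha 0 (by omega) _).trans ?_
            gcongr
      _ = (1 * K ^ t + t * K ^ (t + 1)) * η * ‖x‖ := by ring
      _ ≤ (K * K ^ t + t * K ^ (t + 1)) * η * ‖x‖ := by gcongr
      _ = _ := by push_cast; ring

/-- For large `n` the coefficients are nearly constant over a block of fixed length, so that the
stability of the frozen autoregressions makes the flow over a block a contraction, uniformly over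
the class. -/
lemma exists_flow_contraction (hd : 1 ≤ d) {β L ρ : ℝ} (hβ : 0 < β) (hL : 0 < L)
    (hρ : ρ ∈ Set.Ioo (0 : ℝ) 1) :
    ∃ r N₀ : ℕ, d ≤ r ∧ ∀ n, N₀ ≤ n → ∀ θ ∈ LipBall d β L ∩ StableSet d ρ, ∀ i, i + r ≤ n →
      ∀ x, ‖flow (fun l => θ ((l : ℝ) / n)) i r x‖ ≤ 1 / 2 * ‖x‖ := by
  obtain ⟨C, hC, hpow⟩ := exists_companion_pow_bound hd hρ
  obtain ⟨hρ0, hρ1⟩ := hρ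
  obtain ⟨r, hrd, hr⟩ : ∃ r : ℕ, d ≤ r ∧ C * ((1 + ρ) / 2) ^ r ≤ 1 / 4 := by
    have h : Filter.Tendsto (fun r : ℕ => C * ((1 + ρ) / 2) ^ r) Filter.atTop (nhds (C * 0)) :=
      (tendsto_pow_atTop_nhds_zero_of_lt_one (by linarith) (by linarith)).const_mul C
    rw [mul_zero] at h
    obtain ⟨r, h1, h2⟩ := ((h.eventually_le_const (by norm_num : (0 : ℝ) < 1 / 4)).and
      (Filter.eventually_ge_atTop d)).exists
    exact ⟨r, h2, h1⟩
  set K : ℝ := d * (1 + L) with hK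
  have hd1 : (1 : ℝ) ≤ d := by exact_mod_cast hd
  have hK1 : 1 ≤ K := by rw [hK]; nlinarith
  obtain ⟨N₀, hN₀⟩ : ∃ N₀ : ℕ, ∀ n ≥ N₀, r * K ^ r * (L * ((r : ℝ) / n) ^ β) ≤ 1 / 4 := by
    have h : Filter.Tendsto (fun n : ℕ => r * K ^ r * (L * ((r : ℝ) / n) ^ β)) Filter.atTop
        (nhds (r * K ^ r * (L * (0 : ℝ) ^ β))) :=
      (((tendsto_const_div_atTop_nhds_zero_nat (r : ℝ)).rpow_const
        (Or.inr hβ.le)).const_mul L).const_mul _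
    rw [Real.zero_rpow hβ.ne', mul_zero, mul_zero] at h
    exact Filter.eventually_atTop.1 (h.eventually_le_const (by norm_num))
  refine ⟨r, N₀, hrd, fun n hn θ hθ i hi x => ?_⟩
  have hn0 : (0 : ℝ) < n := by
    have : 0 < n := by omega
    exact_mod_cast this
  have hmem : ∀ l : ℕ, l ≤ n → (l : ℝ) / n ∈ Set.Icc (0 : ℝ) 1 := fun l hl =>
    ⟨by positivity, (div_le_one hn0).2 (by exact_mod_cast hl)⟩
  set η : ℝ := L * ((r : ℝ) / n) ^ β with hη
  have hη0 : 0 ≤ η := by positivity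
  have h1 := norm_flow_sub_pow_le (a := fun l => θ ((l : ℝ) / n)) (i := i) (t := r) hK1 hη0
    (fun s hs x => by
      refine (norm_companion_le _ _).trans ?_
      rw [hK]
      gcongr
      exact hθ.1.2 _ (hmem _ (by omega)))
    (fun s hs => by
      refine (hθ.1.1 _ (hmem _ (by omega)) _ (hmem _ (by omega))).trans ?_
      rw [hη]
      gcongr
      rw [← sub_div, Nat.cast_add, add_sub_cancel_left, abs_of_nonneg (by positivity)]
      gcongr) x
  have h2 := hpow (θ ((i : ℝ) / n)) (fun z hz => hθ.2 z hz _ (hmem i (by omega))) x r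
  calc _ = ‖(flow (fun l => θ ((l : ℝ) / n)) i r x - (companion (θ ((i : ℝ) / n)) ^ r) x)
        + (companion (θ ((i : ℝ) / n)) ^ r) x‖ := by rw [sub_add_cancel]
    _ ≤ 1 / 4 * ‖x‖ + 1 / 4 * ‖x‖ := by
        refine (norm_add_le _ _).trans (add_le_add (h1.trans ?_) (h2.trans ?_))
        · gcongr
          exact hN₀ n hn
        · gcongr
    _ = 1 / 2 * ‖x‖ := by ring

/-! ### The contracting factors -/

/-- The action `w ↦ (I - μ F_μ(x)) w` of one factor of the product. -/
noncomputable def contract (μ : ℝ) (x w : Vec d) : Vec d :=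
  w - (μ * ⟪x, w⟫_ℝ / (1 + μ * ‖x‖ ^ 2)) • x

lemma toEuclideanCLM_factor (μ : ℝ) (x w : Vec d) :
    Matrix.toEuclideanCLM (n := Fin d) (𝕜 := ℝ) (1 - μ • F μ x) w = contract μ x w := by
  have h : ⟪x, w⟫_ℝ = x.ofLp ⬝ᵥ w.ofLp := by
    simp [PiLp.inner_apply, dotProduct, mul_comm]
  ext i
  simp [contract, F, Matrix.vecMulVec_mulVec, h]
  ring

lemma sq_div_mul_norm_sq_le {μ : ℝ} (hμ : 0 ≤ μ) (x : Vec d) (s : ℝ) :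
    (μ * s / (1 + μ * ‖x‖ ^ 2)) ^ 2 * ‖x‖ ^ 2 ≤ μ * s ^ 2 / (1 + μ * ‖x‖ ^ 2) := by
  have hD : 0 < 1 + μ * ‖x‖ ^ 2 := by positivity
  rw [div_pow, div_mul_eq_mul_div, div_le_div_iff₀ (by positivity) hD]
  nlinarith [mul_nonneg (mul_nonneg hμ (sq_nonneg s)) hD.le]

/-- One contraction step loses at least the energy of the excitation. -/
lemma norm_contract_sq_add_le {μ : ℝ} (hμ : 0 ≤ μ) (x w : Vec d) :
    ‖contract μ x w‖ ^ 2 + μ * ⟪x, w⟫_ℝ ^ 2 / (1 + μ * ‖x‖ ^ 2) ≤ ‖w‖ ^ 2 := by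
  have hD : 0 < 1 + μ * ‖x‖ ^ 2 := by positivity
  rw [contract, norm_sub_sq_real, norm_smul, mul_pow, Real.norm_eq_abs, sq_abs,
    real_inner_smul_right, real_inner_comm x w]
  set D := 1 + μ * ‖x‖ ^ 2
  set s := ⟪x, w⟫_ℝ
  have h1 : (μ * s / D) ^ 2 * ‖x‖ ^ 2 ≤ μ * s ^ 2 / D := sq_div_mul_norm_sq_le hμ x s
  have h2 : μ * s / D * s = μ * s ^ 2 / D := by ring
  linarith

lemma norm_contract_le {μ : ℝ} (hμ : 0 ≤ μ) (x w : Vec d) : ‖contract μ x w‖ ≤ ‖w‖ := by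
  have h := norm_contract_sq_add_le hμ x w
  have : 0 ≤ μ * ⟪x, w⟫_ℝ ^ 2 / (1 + μ * ‖x‖ ^ 2) := by positivity
  exact le_of_sq_le_sq (by linarith) (norm_nonneg _)

lemma norm_contract_sub_sq_le {μ : ℝ} (hμ : 0 ≤ μ) (x w : Vec d) :
    ‖contract μ x w - w‖ ^ 2 ≤ ‖w‖ ^ 2 - ‖contract μ x w‖ ^ 2 := by
  have h := norm_contract_sq_add_le hμ x w
  have hD : 0 < 1 + μ * ‖x‖ ^ 2 := by positivity
  have h0 : contract μ x w - w = -((μ * ⟪x, w⟫_ℝ / (1 + μ * ‖x‖ ^ 2)) • x) := by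
    rw [contract]; abel
  rw [h0, norm_neg, norm_smul, mul_pow, Real.norm_eq_abs, sq_abs]
  set D := 1 + μ * ‖x‖ ^ 2
  set s := ⟪x, w⟫_ℝ
  have h1 : (μ * s / D) ^ 2 * ‖x‖ ^ 2 ≤ μ * s ^ 2 / D := sq_div_mul_norm_sq_le hμ x s
  linarith

/-- The excitation of the *initial* vector `w 0` by any later regressor is controlled by the
energy lost in the meantime: either `w` has hardly moved and feels that regressor, or it has
moved and has lost energy by doing so. -/
lemma excitation_le {μ : ℝ} (hμ : 0 ≤ μ) (x w : ℕ → Vec d) (t : ℕ)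
    (hw : ∀ s ≤ t, w (s + 1) = contract μ (x (s + 1)) (w s)) :
    μ * ⟪x (t + 1), w 0⟫_ℝ ^ 2 / (1 + μ * ‖x (t + 1)‖ ^ 2)
      ≤ 2 ^ (t + 1) * (‖w 0‖ ^ 2 - ‖w (t + 1)‖ ^ 2) := by
  have hmove : ∀ s ≤ t, ‖w s - w 0‖ ^ 2 ≤ 2 ^ s * (‖w 0‖ ^ 2 - ‖w s‖ ^ 2) := by
    intro s
    induction s with
    | zero => simp
    | succ s ih =>
      intro hs
      have h1 := ih (by omega)
      have h2 := norm_contract_sub_sq_le hμ (x (s + 1)) (w s)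
      rw [← hw s (by omega)] at h2
      have h3 : ‖w (s + 1) - w 0‖ ^ 2 ≤ 2 * ‖w (s + 1) - w s‖ ^ 2 + 2 * ‖w s - w 0‖ ^ 2 := by
        have h4 : ‖w (s + 1) - w 0‖ ≤ ‖w (s + 1) - w s‖ + ‖w s - w 0‖ :=
          norm_sub_le_norm_sub_add_norm_sub _ _ _
        have h5 := pow_le_pow_left₀ (norm_nonneg _) h4 2
        nlinarith [sq_nonneg (‖w (s + 1) - w s‖ - ‖w s - w 0‖)]
      have h6 : (1 : ℝ) ≤ 2 ^ s := one_le_pow₀ (by norm_num)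
      have h7 : 0 ≤ ‖w s‖ ^ 2 - ‖w (s + 1)‖ ^ 2 := (sq_nonneg _).trans h2
      rw [pow_succ (2 : ℝ)]
      nlinarith
  have h1 := hmove t le_rfl
  have h2 := norm_contract_sq_add_le hμ (x (t + 1)) (w t)
  rw [← hw t le_rfl] at h2
  set D := 1 + μ * ‖x (t + 1)‖ ^ 2 with hDdef
  have hD : 0 < D := by positivity
  have h3 : ⟪x (t + 1), w 0⟫_ℝ ^ 2
      ≤ 2 * ⟪x (t + 1), w t⟫_ℝ ^ 2 + 2 * (‖x (t + 1)‖ ^ 2 * ‖w t - w 0‖ ^ 2) := by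
    have h4 : ⟪x (t + 1), w 0⟫_ℝ = ⟪x (t + 1), w t⟫_ℝ - ⟪x (t + 1), w t - w 0⟫_ℝ := by
      rw [inner_sub_right]; ring
    have h5 := abs_real_inner_le_norm (x (t + 1)) (w t - w 0)
    have h6 := pow_le_pow_left₀ (abs_nonneg _) h5 2
    rw [sq_abs, mul_pow] at h6
    rw [h4]
    nlinarith [sq_nonneg (⟪x (t + 1), w t⟫_ℝ + ⟪x (t + 1), w t - w 0⟫_ℝ)]
  have h4 : μ * ⟪x (t + 1), w 0⟫_ℝ ^ 2 / D
      ≤ 2 * (μ * ⟪x (t + 1), w t⟫_ℝ ^ 2 / D) + 2 * ‖w t - w 0‖ ^ 2 := by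
    have h5 : μ * ‖x (t + 1)‖ ^ 2 ≤ D := by rw [hDdef]; linarith
    have h6 := mul_le_mul_of_nonneg_right h5 (sq_nonneg ‖w t - w 0‖)
    have h7 := mul_le_mul_of_nonneg_left h3 hμ
    rw [div_le_iff₀ hD, add_mul, mul_assoc 2, div_mul_cancel₀ _ hD.ne']
    nlinarith
  have h6 : (1 : ℝ) ≤ 2 ^ t := one_le_pow₀ (by norm_num)
  have h7 : 0 ≤ μ * ⟪x (t + 1), w t⟫_ℝ ^ 2 / D := by positivity
  have h8 := mul_le_mul_of_nonneg_right h6 (by linarith : 0 ≤ ‖w t‖ ^ 2 - ‖w (t + 1)‖ ^ 2)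
  rw [pow_succ (2 : ℝ)]
  nlinarith

/-- The action of the product of the factors on the vector `u`. -/
noncomputable def prodVec (μ : ℝ) (x : ℕ → Vec d) (j : ℕ) (u : Vec d) (k : ℕ) : Vec d :=
  Matrix.toEuclideanCLM (n := Fin d) (𝕜 := ℝ) (matProd μ x j k) u

lemma prodVec_self (μ : ℝ) (x : ℕ → Vec d) (j : ℕ) (u : Vec d) : prodVec μ x j u j = u := by
  cases j <;> simp [prodVec, matProd]

lemma prodVec_succ (μ : ℝ) (x : ℕ → Vec d) {j k : ℕ} (hjk : j ≤ k) (u : Vec d) :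
    prodVec μ x j u (k + 1) = contract μ (x (k + 1)) (prodVec μ x j u k) := by
  rw [← toEuclideanCLM_factor]
  simp only [prodVec, matProd, if_pos hjk, map_mul]
  rfl

lemma norm_prodVec_le_of_le {μ : ℝ} (hμ : 0 ≤ μ) (x : ℕ → Vec d) {j k l : ℕ} (hjk : j ≤ k)
    (hkl : k ≤ l) (u : Vec d) : ‖prodVec μ x j u l‖ ≤ ‖prodVec μ x j u k‖ := by
  induction l, hkl using Nat.le_induction with
  | base => exact le_rfl
  | succ l hl ih =>
    rw [prodVec_succ μ x (hjk.trans hl)]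
    exact (norm_contract_le hμ _ _).trans ih

lemma norm_prodVec_le {μ : ℝ} (hμ : 0 ≤ μ) (x : ℕ → Vec d) {j k : ℕ} (hjk : j ≤ k) (u : Vec d) :
    ‖prodVec μ x j u k‖ ≤ ‖u‖ := by
  simpa [prodVec_self] using norm_prodVec_le_of_le hμ x le_rfl hjk u

lemma norm_matProd_le_one {μ : ℝ} (hμ : 0 ≤ μ) (x : ℕ → Vec d) {j k : ℕ} (hjk : j ≤ k) :
    ‖matProd μ x j k‖ ≤ 1 := by
  rw [← Matrix.l2_opNorm_toEuclideanCLM]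
  refine ContinuousLinearMap.opNorm_le_bound _ zero_le_one fun u => ?_
  rw [one_mul]
  exact norm_prodVec_le hμ x hjk u

lemma norm_matProd_sq_le (μ : ℝ) (x : ℕ → Vec d) (j k : ℕ) :
    ‖matProd μ x j k‖ ^ 2
      ≤ d * ∑ i, ‖prodVec μ x j (EuclideanSpace.single i (1 : ℝ)) k‖ ^ 2 := by
  have h : ‖matProd μ x j k‖ ≤ ∑ i, ‖prodVec μ x j (EuclideanSpace.single i (1 : ℝ)) k‖ := by
    rw [← Matrix.l2_opNorm_toEuclideanCLM]
    refine ContinuousLinearMap.opNorm_le_bound _ (Finset.sum_nonneg fun i _ => norm_nonneg _)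
      fun u => ?_
    have hu : u = ∑ i, u i • EuclideanSpace.single i (1 : ℝ) := by
      ext j
      simp [Finset.sum_apply, Pi.single_apply]
    conv_lhs => rw [hu]
    rw [map_sum, Finset.sum_mul]
    refine (norm_sum_le _ _).trans (Finset.sum_le_sum fun i _ => ?_)
    rw [map_smul, norm_smul, mul_comm]
    exact mul_le_mul_of_nonneg_left (abs_apply_le_norm u i) (norm_nonneg _)
  calc _ ≤ (∑ i, ‖prodVec μ x j (EuclideanSpace.single i (1 : ℝ)) k‖) ^ 2 := by gcongr
    _ ≤ _ := by
        simpa using sq_sum_le_card_mul_sum_sq (s := Finset.univ)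
          (f := fun i : Fin d => ‖prodVec μ x j (EuclideanSpace.single i (1 : ℝ)) k‖)

/-! ### Lag processes driven by innovations -/

section Innovations

/-- The variables `ε 1, …, ε n` are innovations for the filtration `𝓕`: standardized, adapted, and
independent of the past. The constant `c` is a lower bound for their first absolute moments. -/
structure IsInnovation {Ω : Type*} {m : MeasurableSpace Ω} (P : Measure Ω) (𝓕 : Filtration ℕ m)
    (ε : ℕ → Ω → ℝ) (n : ℕ) (c : ℝ) : Prop where
  adapted : ∀ l < n, Measurable[𝓕 (l + 1)] (ε (l + 1))
  indep : ∀ l < n, Indep (𝓕 l) (MeasurableSpace.comap (ε (l + 1)) inferInstance) P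
  memLp : ∀ l < n, MemLp (ε (l + 1)) 2 P
  integral_eq_zero : ∀ l < n, ∫ ω, ε (l + 1) ω ∂P = 0
  integral_sq : ∀ l < n, ∫ ω, ε (l + 1) ω ^ 2 ∂P = 1
  le_integral_abs : ∀ l < n, c ≤ ∫ ω, |ε (l + 1) ω| ∂P

/-- The process `X` solves, up to time `n`, the recursion of the lag vectors with coefficients
`a l`, scales `s l` and innovations `ε`, from a square-integrable initial condition. -/
structure IsLagProcess {Ω : Type*} {m : MeasurableSpace Ω} (P : Measure Ω) (𝓕 : Filtration ℕ m)
    (ε : ℕ → Ω → ℝ) (n : ℕ) (a : ℕ → Vec d) (s : ℕ → ℝ) (X : ℕ → Ω → Vec d) : Prop where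
  measurable_zero : Measurable[𝓕 0] (X 0)
  integrable_zero : Integrable (fun ω => ‖X 0 ω‖ ^ 2) P
  succ : ∀ l < n, ∀ ω, X (l + 1) ω = companion (a l) (X l ω) + (s l * ε (l + 1) ω) • firstVec d

variable {Ω : Type*} {m : MeasurableSpace Ω} {P : Measure Ω}
  {𝓕 : Filtration ℕ m} {ε : ℕ → Ω → ℝ} {n : ℕ} {c : ℝ}

lemma measurable_linearMap {E E' : Type*} [NormedAddCommGroup E] [NormedSpace ℝ E]
    [FiniteDimensional ℝ E] [MeasurableSpace E] [BorelSpace E] [NormedAddCommGroup E']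
    [NormedSpace ℝ E'] [MeasurableSpace E'] [BorelSpace E'] (f : E →ₗ[ℝ] E') : Measurable f :=
  (LinearMap.continuous_of_finiteDimensional f).measurable

namespace IsInnovation

lemma indepFun (h : IsInnovation P 𝓕 ε n c) {l : ℕ} (hl : l < n) {S : Type*} [MeasurableSpace S]
    {f : Ω → S} (hf : Measurable[𝓕 l] f) : IndepFun f (ε (l + 1)) P :=
  indep_of_indep_of_le_left (h.indep l hl) hf.comap_le

lemma measurable (h : IsInnovation P 𝓕 ε n c) {l : ℕ} (hl : l < n) : Measurable (ε (l + 1)) :=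
  (h.adapted l hl).mono (𝓕.le _) le_rfl

lemma integrable_mul_sq (h : IsInnovation P 𝓕 ε n c) {l : ℕ} (hl : l < n) {τ : Ω → ℝ}
    (hτ : Measurable[𝓕 l] τ) (hτi : Integrable τ P) :
    Integrable (fun ω => τ ω * ε (l + 1) ω ^ 2) P :=
  ((h.indepFun hl hτ).comp measurable_id (measurable_id.pow_const 2)).integrable_mul hτi
    (h.memLp l hl).integrable_sq

lemma integral_mul_sq (h : IsInnovation P 𝓕 ε n c) {l : ℕ} (hl : l < n) {τ : Ω → ℝ}
    (hτ : Measurable[𝓕 l] τ) : ∫ ω, τ ω * ε (l + 1) ω ^ 2 ∂P = ∫ ω, τ ω ∂P := by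
  have := ((h.indepFun hl hτ).comp measurable_id
    (measurable_id.pow_const 2)).integral_fun_mul_eq_mul_integral
    (hτ.mono (𝓕.le _) le_rfl).aestronglyMeasurable
    ((h.measurable hl).pow_const 2).aestronglyMeasurable
  simpa [h.integral_sq l hl] using this

end IsInnovation

lemma integrable_mul_of_bounded {τ V : Ω → ℝ} (hτ : Measurable τ) {b : ℝ}
    (hb : ∀ ω, |τ ω| ≤ b) (hV : Integrable V P) : Integrable (fun ω => τ ω * V ω) P :=
  hV.bdd_mul hτ.aestronglyMeasurable (.of_forall hb)

/-- Accumulated noise energy over `t` steps, when the companion maps are bounded by `K` and the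
scales by `b`. -/
noncomputable def noiseBound (K b : ℝ) : ℕ → ℝ
  | 0 => 0
  | t + 1 => 2 * K ^ 2 * noiseBound K b t + 2 * b ^ 2

lemma noiseBound_nonneg (K b : ℝ) (t : ℕ) : 0 ≤ noiseBound K b t := by
  induction t with
  | zero => exact le_rfl
  | succ t ih => rw [noiseBound]; positivity

lemma norm_add_sq_le_two_mul {E : Type*} [SeminormedAddCommGroup E] (x y : E) :
    ‖x + y‖ ^ 2 ≤ 2 * ‖x‖ ^ 2 + 2 * ‖y‖ ^ 2 := by
  have h := pow_le_pow_left₀ (norm_nonneg _) (norm_add_le x y) 2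
  nlinarith [sq_nonneg (‖x‖ - ‖y‖)]

namespace IsLagProcess

variable {a : ℕ → Vec d} {s : ℕ → ℝ} {X : ℕ → Ω → Vec d}

lemma adapted (hX : IsLagProcess P 𝓕 ε n a s X) (hε : IsInnovation P 𝓕 ε n c) {l : ℕ}
    (hl : l ≤ n) : Measurable[𝓕 l] (X l) := by
  induction l with
  | zero => exact hX.measurable_zero
  | succ l ih =>
    rw [show X (l + 1) = fun ω => companion (a l) (X l ω) + (s l * ε (l + 1) ω) • firstVec d from
      funext (hX.succ l hl)]
    have h1 : Measurable[𝓕 (l + 1)] (X l) :=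
      (ih (by omega)).mono (𝓕.mono (Nat.le_succ l)) le_rfl
    have h2 := hε.adapted l hl
    exact ((measurable_linearMap _).comp h1).add ((h2.const_mul _).smul_const _)

lemma measurable (hX : IsLagProcess P 𝓕 ε n a s X) (hε : IsInnovation P 𝓕 ε n c) {l : ℕ}
    (hl : l ≤ n) : Measurable (X l) :=
  (hX.adapted hε hl).mono (𝓕.le _) le_rfl

lemma integrable_norm_sq (hX : IsLagProcess P 𝓕 ε n a s X) (hε : IsInnovation P 𝓕 ε n c) {l : ℕ}
    (hl : l ≤ n) : Integrable (fun ω => ‖X l ω‖ ^ 2) P := by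
  induction l with
  | zero => exact hX.integrable_zero
  | succ l ih =>
    set K : ℝ := d * (1 + ‖a l‖)
    refine Integrable.mono' (((ih (by omega)).const_mul (2 * K ^ 2)).add
      ((hε.memLp l hl).integrable_sq.const_mul (2 * s l ^ 2)))
      ((hX.measurable hε hl).norm.pow_const 2).aestronglyMeasurable (.of_forall fun ω => ?_)
    rw [Real.norm_of_nonneg (by positivity), hX.succ l hl]
    refine (norm_add_sq_le_two_mul _ _).trans (add_le_add ?_ ?_)
    · have := pow_le_pow_left₀ (norm_nonneg _) (norm_companion_le (a l) (X l ω)) 2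
      rw [mul_pow] at this
      linarith
    · have := pow_le_one₀ (norm_nonneg _) (norm_firstVec_le d) (n := 2)
      rw [norm_smul, mul_pow, Real.norm_eq_abs, sq_abs]
      have := mul_le_mul_of_nonneg_left this (sq_nonneg (s l * ε (l + 1) ω))
      linarith

end IsLagProcess

variable [IsProbabilityMeasure P]

namespace IsInnovation

lemma integrable (h : IsInnovation P 𝓕 ε n c) {l : ℕ} (hl : l < n) :
    Integrable (ε (l + 1)) P :=
  (h.memLp l hl).integrable one_le_two

lemma integrable_add_mul (h : IsInnovation P 𝓕 ε n c) {l : ℕ} (hl : l < n) {A B : Ω → ℝ}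
    (hB : Measurable[𝓕 l] B) (hAi : Integrable A P) (hBi : Integrable B P) :
    Integrable (fun ω => A ω + B ω * ε (l + 1) ω) P :=
  hAi.add ((h.indepFun hl hB).integrable_mul hBi (h.integrable hl))

/-- Jensen's inequality given the past: averaging over the innovation can only increase `|A|`. -/
lemma integral_abs_le (h : IsInnovation P 𝓕 ε n c) {l : ℕ} (hl : l < n) {A B : Ω → ℝ}
    (hA : Measurable[𝓕 l] A) (hB : Measurable[𝓕 l] B) (hAi : Integrable A P)
    (hBi : Integrable B P) :
    ∫ ω, |A ω| ∂P ≤ ∫ ω, |A ω + B ω * ε (l + 1) ω| ∂P := by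
  set f : Ω → ℝ := fun ω => if 0 ≤ A ω then B ω else -B ω with hf
  have hfm : Measurable[𝓕 l] f :=
    Measurable.ite (measurableSet_le measurable_const hA) hB hB.neg
  have hfi : Integrable f P := by
    refine hBi.mono (hfm.mono (𝓕.le _) le_rfl).aestronglyMeasurable (.of_forall fun ω => ?_)
    simp only [hf]
    split_ifs <;> simp
  have hfε : ∫ ω, f ω * ε (l + 1) ω ∂P = 0 := by
    rw [(h.indepFun hl hfm).integral_fun_mul_eq_mul_integral hfi.aestronglyMeasurable
      (h.measurable hl).aestronglyMeasurable, h.integral_eq_zero l hl, mul_zero]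
  have hfεi : Integrable (fun ω => f ω * ε (l + 1) ω) P :=
    (h.indepFun hl hfm).integrable_mul hfi (h.integrable hl)
  calc ∫ ω, |A ω| ∂P = ∫ ω, (|A ω| + f ω * ε (l + 1) ω) ∂P := by
        rw [integral_add hAi.abs hfεi, hfε, add_zero]
    _ ≤ _ := by
        refine integral_mono (hAi.abs.add hfεi) (h.integrable_add_mul hl hB hAi hBi).abs
          fun ω => ?_
        simp only [hf]
        split_ifs with h0
        · rw [abs_of_nonneg h0]
          exact le_abs_self _
        · rw [abs_of_neg (not_le.1 h0)]
          refine le_trans (le_of_eq ?_) (neg_le_abs _)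
          ring

/-- The fluctuation of one innovation cannot be compensated by the past. -/
lemma integral_abs_le_two_mul (h : IsInnovation P 𝓕 ε n c) {l : ℕ} (hl : l < n) {A B : Ω → ℝ}
    (hA : Measurable[𝓕 l] A) (hB : Measurable[𝓕 l] B) (hAi : Integrable A P)
    (hBi : Integrable B P) :
    c * ∫ ω, |B ω| ∂P ≤ 2 * ∫ ω, |A ω + B ω * ε (l + 1) ω| ∂P := by
  have h1 := h.integral_abs_le hl hA hB hAi hBi
  have hind : IndepFun (fun ω => |B ω|) (fun ω => |ε (l + 1) ω|) P :=
    (h.indepFun hl hB).comp (φ := fun x : ℝ => |x|) (ψ := fun x : ℝ => |x|)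
      measurable_abs measurable_abs
  have h2 : ∫ ω, |B ω| * |ε (l + 1) ω| ∂P = (∫ ω, |B ω| ∂P) * ∫ ω, |ε (l + 1) ω| ∂P :=
    hind.integral_fun_mul_eq_mul_integral hBi.abs.aestronglyMeasurable
      (h.integrable hl).abs.aestronglyMeasurable
  have h3 : Integrable (fun ω => |B ω| * |ε (l + 1) ω|) P :=
    hind.integrable_mul hBi.abs (h.integrable hl).abs
  have h4 : (∫ ω, |B ω| * |ε (l + 1) ω| ∂P) - ∫ ω, |A ω| ∂P
      ≤ ∫ ω, |A ω + B ω * ε (l + 1) ω| ∂P := by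
    rw [← integral_sub h3 hAi.abs]
    refine integral_mono (h3.sub hAi.abs) (h.integrable_add_mul hl hB hAi hBi).abs fun ω => ?_
    have := abs_sub_abs_le_abs_sub (B ω * ε (l + 1) ω) (-A ω)
    rw [abs_neg, abs_mul, sub_neg_eq_add, add_comm (B ω * _)] at this
    exact this
  have h5 : c * ∫ ω, |B ω| ∂P ≤ (∫ ω, |B ω| ∂P) * ∫ ω, |ε (l + 1) ω| ∂P := by
    rw [mul_comm]
    exact mul_le_mul_of_nonneg_left (h.le_integral_abs l hl)
      (integral_nonneg fun ω => abs_nonneg _)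
  linarith

end IsInnovation

namespace IsLagProcess

variable {a : ℕ → Vec d} {s : ℕ → ℝ} {X : ℕ → Ω → Vec d}

lemma integrable_norm (hX : IsLagProcess P 𝓕 ε n a s X) (hε : IsInnovation P 𝓕 ε n c) {l : ℕ}
    (hl : l ≤ n) : Integrable (fun ω => ‖X l ω‖) P := by
  refine Integrable.mono' ((integrable_const (1 : ℝ)).add (hX.integrable_norm_sq hε hl))
    (hX.measurable hε hl).norm.aestronglyMeasurable (.of_forall fun ω => ?_)
  rw [norm_norm]
  simp only [Pi.add_apply]
  nlinarith [sq_nonneg (‖X l ω‖ - 1)]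

lemma integrable_inner (hX : IsLagProcess P 𝓕 ε n a s X) (hε : IsInnovation P 𝓕 ε n c) {l : ℕ}
    (hl : l ≤ n) {v : Ω → Vec d} (hv : Measurable v) {b : ℝ} (hb : ∀ ω, ‖v ω‖ ≤ b) :
    Integrable (fun ω => ⟪v ω, X l ω⟫_ℝ) P := by
  refine Integrable.mono' ((hX.integrable_norm hε hl).const_mul b)
    (hv.inner (hX.measurable hε hl)).aestronglyMeasurable (.of_forall fun ω => ?_)
  rw [Real.norm_eq_abs]
  exact (abs_real_inner_le_norm _ _).trans (mul_le_mul_of_nonneg_right (hb ω) (norm_nonneg _))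

/-- The second moment of the accumulated noise, with a weight from the past. -/
lemma integral_noise_le (hX : IsLagProcess P 𝓕 ε n a s X) (hε : IsInnovation P 𝓕 ε n c) {K b : ℝ}
    (ha : ∀ l < n, ∀ x, ‖companion (a l) x‖ ≤ K * ‖x‖) (hs : ∀ l < n, |s l| ≤ b) {i t : ℕ}
    (hit : i + t ≤ n) {τ : Ω → ℝ} (hτ : Measurable[𝓕 i] τ) (hτ0 : ∀ ω, 0 ≤ τ ω)
    (hτi : Integrable τ P) :
    Integrable (fun ω => τ ω * ‖X (i + t) ω - flow a i t (X i ω)‖ ^ 2) P ∧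
      ∫ ω, τ ω * ‖X (i + t) ω - flow a i t (X i ω)‖ ^ 2 ∂P
        ≤ noiseBound K b t * ∫ ω, τ ω ∂P := by
  induction t with
  | zero => simp [flow, noiseBound]
  | succ t ih =>
    obtain ⟨ih1, ih2⟩ := ih (by omega)
    have hl : i + t < n := by omega
    have hτt : Measurable[𝓕 (i + t)] τ := hτ.mono (𝓕.mono (by omega)) le_rfl
    have hpt : ∀ ω, τ ω * ‖X (i + (t + 1)) ω - flow a i (t + 1) (X i ω)‖ ^ 2
        ≤ 2 * K ^ 2 * (τ ω * ‖X (i + t) ω - flow a i t (X i ω)‖ ^ 2)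
          + 2 * b ^ 2 * (τ ω * ε (i + t + 1) ω ^ 2) := by
      intro ω
      have h1 : X (i + (t + 1)) ω - flow a i (t + 1) (X i ω)
          = companion (a (i + t)) (X (i + t) ω - flow a i t (X i ω))
            + (s (i + t) * ε (i + t + 1) ω) • firstVec d := by
        rw [← add_assoc, hX.succ _ hl, flow_succ, map_sub]
        abel
      have h2 := pow_le_pow_left₀ (norm_nonneg _) (ha _ hl (X (i + t) ω - flow a i t (X i ω))) 2
      have h3 : ‖(s (i + t) * ε (i + t + 1) ω) • firstVec d‖ ^ 2
          ≤ b ^ 2 * ε (i + t + 1) ω ^ 2 := by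
        have h4 := pow_le_one₀ (norm_nonneg _) (norm_firstVec_le d) (n := 2)
        have h5 := pow_le_pow_left₀ (abs_nonneg _) (hs _ hl) 2
        rw [norm_smul, mul_pow, Real.norm_eq_abs, abs_mul, mul_pow, sq_abs (ε _ ω)]
        calc _ ≤ b ^ 2 * ε (i + t + 1) ω ^ 2 * 1 := by gcongr
          _ = _ := mul_one _
      have h6 := norm_add_sq_le_two_mul
        (companion (a (i + t)) (X (i + t) ω - flow a i t (X i ω)))
        ((s (i + t) * ε (i + t + 1) ω) • firstVec d)
      rw [h1]
      rw [mul_pow] at h2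
      have := mul_le_mul_of_nonneg_left (h6.trans (add_le_add
        (mul_le_mul_of_nonneg_left h2 zero_le_two) (mul_le_mul_of_nonneg_left h3 zero_le_two)))
        (hτ0 ω)
      linarith
    have hsum : Integrable (fun ω => 2 * K ^ 2 * (τ ω * ‖X (i + t) ω - flow a i t (X i ω)‖ ^ 2)
          + 2 * b ^ 2 * (τ ω * ε (i + t + 1) ω ^ 2)) P :=
      (ih1.const_mul _).add ((hε.integrable_mul_sq hl hτt hτi).const_mul _)
    have hint : Integrable (fun ω => τ ω * ‖X (i + (t + 1)) ω - flow a i (t + 1) (X i ω)‖ ^ 2) P := by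
      refine Integrable.mono' hsum ?_ (.of_forall fun ω => ?_)
      · refine ((hτ.mono (𝓕.le _) le_rfl).mul (Measurable.pow_const (Measurable.norm ?_)
          2)).aestronglyMeasurable
        exact (hX.measurable hε hit).sub ((measurable_linearMap _).comp
          (hX.measurable hε (by omega)))
      · rw [Real.norm_of_nonneg (mul_nonneg (hτ0 ω) (sq_nonneg _))]
        exact hpt ω
    refine ⟨hint, (integral_mono hint hsum hpt).trans ?_⟩
    rw [integral_add (ih1.const_mul _) ((hε.integrable_mul_sq hl hτt hτi).const_mul _),
      integral_const_mul, integral_const_mul, hε.integral_mul_sq hl hτt, noiseBound]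
    have := mul_le_mul_of_nonneg_left ih2 (by positivity : 0 ≤ 2 * K ^ 2)
    linarith

/-- Drift of the second moment over `t` steps, with a weight from the past. -/
lemma integral_mul_norm_sq_le (hX : IsLagProcess P 𝓕 ε n a s X) (hε : IsInnovation P 𝓕 ε n c)
    {K b q : ℝ} (ha : ∀ l < n, ∀ x, ‖companion (a l) x‖ ≤ K * ‖x‖) (hs : ∀ l < n, |s l| ≤ b)
    {i t : ℕ} (hit : i + t ≤ n) (hflow : ∀ x, ‖flow a i t x‖ ≤ q * ‖x‖) {τ : Ω → ℝ}
    (hτ : Measurable[𝓕 i] τ) (hτ0 : ∀ ω, 0 ≤ τ ω) {C : ℝ} (hC : ∀ ω, τ ω ≤ C) :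
    ∫ ω, τ ω * ‖X (i + t) ω‖ ^ 2 ∂P
      ≤ ∫ ω, τ ω * (2 * q ^ 2 * ‖X i ω‖ ^ 2 + 2 * noiseBound K b t) ∂P := by
  have hτm : Measurable τ := hτ.mono (𝓕.le _) le_rfl
  have hτC : ∀ ω, |τ ω| ≤ C := fun ω => by rw [abs_of_nonneg (hτ0 ω)]; exact hC ω
  have hτi : Integrable τ P := by
    simpa using integrable_mul_of_bounded hτm hτC (integrable_const (1 : ℝ))
  obtain ⟨h1, h2⟩ := hX.integral_noise_le hε ha hs hit hτ hτ0 hτi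
  have h3 : Integrable (fun ω => τ ω * ‖X i ω‖ ^ 2) P :=
    integrable_mul_of_bounded hτm hτC (hX.integrable_norm_sq hε (by omega))
  calc ∫ ω, τ ω * ‖X (i + t) ω‖ ^ 2 ∂P
      ≤ ∫ ω, (2 * q ^ 2 * (τ ω * ‖X i ω‖ ^ 2)
          + 2 * (τ ω * ‖X (i + t) ω - flow a i t (X i ω)‖ ^ 2)) ∂P := by
        refine integral_mono
          (integrable_mul_of_bounded hτm hτC (hX.integrable_norm_sq hε hit))
          ((h3.const_mul _).add (h1.const_mul _)) fun ω => ?_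
        have h4 := norm_add_sq_le_two_mul (flow a i t (X i ω))
          (X (i + t) ω - flow a i t (X i ω))
        rw [add_sub_cancel] at h4
        have h5 := pow_le_pow_left₀ (norm_nonneg _) (hflow (X i ω)) 2
        rw [mul_pow] at h5
        have := mul_le_mul_of_nonneg_left h4 (hτ0 ω)
        have := mul_le_mul_of_nonneg_left h5 (hτ0 ω)
        simp only
        linarith
    _ ≤ 2 * q ^ 2 * ∫ ω, τ ω * ‖X i ω‖ ^ 2 ∂P + 2 * noiseBound K b t * ∫ ω, τ ω ∂P := by
        rw [integral_add (h3.const_mul _) (h1.const_mul _), integral_const_mul,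
          integral_const_mul]
        linarith
    _ = _ := by
        rw [← integral_const_mul, ← integral_const_mul,
          ← integral_add (h3.const_mul _) (hτi.const_mul _)]
        congr 1
        funext ω
        ring

/-- Persistence of excitation, in `L¹`: after `r ≥ d` steps the innovations have excited every
direction `v` chosen in the past. -/
lemma integral_norm_le_integral_inner (hd : 1 ≤ d) (hX : IsLagProcess P 𝓕 ε n a s X)
    (hε : IsInnovation P 𝓕 ε n c) {L σm : ℝ} (hc : 0 ≤ c)
    (ha : ∀ l < n, ‖a l‖ ≤ L) (hs : ∀ l < n, σm ≤ s l) (hσm : 0 ≤ σm) {i r : ℕ} (hr : d ≤ r)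
    (hir : i + r ≤ n) {v : Ω → Vec d} (hv : Measurable[𝓕 i] v) {b : ℝ} (hb : ∀ ω, ‖v ω‖ ≤ b) :
    c * σm * ∫ ω, ‖v ω‖ ∂P
      ≤ 2 * d ^ 2 * (1 + L) * ∫ ω, |⟪v ω, X (i + r) ω⟫_ℝ| ∂P := by
  have hL : 0 ≤ L := (norm_nonneg _).trans (ha i (by omega))
  -- `u m` is `v` pulled back over `m` steps from time `i + r`; its first coordinate weighs the
  -- innovation of that step
  set T : ℕ → Vec d →ₗ[ℝ] Vec d := fun m => LinearMap.adjoint (companion (a (i + r - 1 - m)))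
    with hT
  set u : ℕ → Ω → Vec d := fun m => Nat.rec v (fun m u ω => T m (u ω)) m with hu
  have hu_succ : ∀ m ω, u (m + 1) ω = T m (u m ω) := fun _ _ => rfl
  have hum : ∀ m, Measurable[𝓕 i] (u m) := by
    intro m
    induction m with
    | zero => exact hv
    | succ m ih => exact (measurable_linearMap (T m)).comp ih
  have hub : ∀ m, ∃ b, ∀ ω, ‖u m ω‖ ≤ b := by
    intro m
    induction m with
    | zero => exact ⟨b, hb⟩
    | succ m ih =>
      obtain ⟨b, hb⟩ := ih
      refine ⟨‖LinearMap.toContinuousLinearMap (T m)‖ * b, fun ω => ?_⟩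
      rw [hu_succ]
      exact ((LinearMap.toContinuousLinearMap (T m)).le_opNorm _).trans
        (mul_le_mul_of_nonneg_left (hb ω) (norm_nonneg _))
  have hu0 : ∀ m ω, |u m ω ⟨0, hd⟩| ≤ ‖u m ω‖ := fun m ω => abs_apply_le_norm _ _
  have hu0m : ∀ m, Measurable[𝓕 i] fun ω => u m ω ⟨0, hd⟩ := fun m =>
    (measurable_linearMap (EuclideanSpace.proj (𝕜 := ℝ) (⟨0, hd⟩ : Fin d)).toLinearMap).comp (hum m)
  have hle : ∀ m, Measurable (u m) := fun m => (hum m).mono (𝓕.le _) le_rfl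
  have hu0i : ∀ m, Integrable (fun ω => u m ω ⟨0, hd⟩) P := by
    intro m
    obtain ⟨b, hb⟩ := hub m
    exact Integrable.of_bound ((hu0m m).mono (𝓕.le _) le_rfl).aestronglyMeasurable b
      (.of_forall fun ω => (hu0 m ω).trans (hb ω))
  have hstep : ∀ m < r, ∀ ω, ⟪u m ω, X (i + r - m) ω⟫_ℝ
      = ⟪u (m + 1) ω, X (i + r - (m + 1)) ω⟫_ℝ
        + (s (i + r - 1 - m) * u m ω ⟨0, hd⟩) * ε (i + r - 1 - m + 1) ω := by
    intro m hm ω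
    have h1 : i + r - m = (i + r - 1 - m) + 1 := by omega
    have h2 : i + r - (m + 1) = i + r - 1 - m := by omega
    rw [h1, h2, hX.succ _ (by omega), inner_add_right, real_inner_smul_right, inner_firstVec hd,
      hu_succ, hT, LinearMap.adjoint_inner_left]
    ring
  have hone : ∀ m < r,
      ∫ ω, |⟪u (m + 1) ω, X (i + r - (m + 1)) ω⟫_ℝ| ∂P ≤ ∫ ω, |⟪u m ω, X (i + r - m) ω⟫_ℝ| ∂P ∧
      c * ∫ ω, |s (i + r - 1 - m) * u m ω ⟨0, hd⟩| ∂P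
        ≤ 2 * ∫ ω, |⟪u m ω, X (i + r - m) ω⟫_ℝ| ∂P := by
    intro m hm
    obtain ⟨b', hb'⟩ := hub (m + 1)
    have h2 : i + r - (m + 1) = i + r - 1 - m := by omega
    have hle' : 𝓕 i ≤ 𝓕 (i + r - 1 - m) := 𝓕.mono (by omega)
    have hA : Measurable[𝓕 (i + r - 1 - m)] fun ω => ⟪u (m + 1) ω, X (i + r - (m + 1)) ω⟫_ℝ := by
      rw [h2]
      exact Measurable.inner ((hum (m + 1)).mono hle' le_rfl) (hX.adapted hε (by omega))
    have hB : Measurable[𝓕 (i + r - 1 - m)] fun ω => s (i + r - 1 - m) * u m ω ⟨0, hd⟩ :=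
      ((hu0m m).mono hle' le_rfl).const_mul _
    have hAi := hX.integrable_inner hε (l := i + r - (m + 1)) (by omega) (hle (m + 1)) hb'
    have hBi := (hu0i m).const_mul (s (i + r - 1 - m))
    simp only [hstep m hm]
    exact ⟨hε.integral_abs_le (by omega) hA hB hAi hBi,
      hε.integral_abs_le_two_mul (by omega) hA hB hAi hBi⟩
  have hmono : ∀ m ≤ r, ∫ ω, |⟪u m ω, X (i + r - m) ω⟫_ℝ| ∂P
      ≤ ∫ ω, |⟪v ω, X (i + r) ω⟫_ℝ| ∂P := by
    intro m
    induction m with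
    | zero => intro _; exact le_rfl
    | succ m ih => intro hm; exact (hone m (by omega)).1.trans (ih (by omega))
  have hcoord : ∀ m < d, c * σm * ∫ ω, |u m ω ⟨0, hd⟩| ∂P
      ≤ 2 * ∫ ω, |⟪v ω, X (i + r) ω⟫_ℝ| ∂P := by
    intro m hm
    have h1 := (hone m (by omega)).2
    have h2 := hmono m (by omega)
    have h3 : σm * ∫ ω, |u m ω ⟨0, hd⟩| ∂P ≤ ∫ ω, |s (i + r - 1 - m) * u m ω ⟨0, hd⟩| ∂P := by
      simp only [abs_mul]
      rw [integral_const_mul]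
      have := hs (i + r - 1 - m) (by omega)
      exact mul_le_mul_of_nonneg_right (this.trans (le_abs_self _))
        (integral_nonneg fun ω => abs_nonneg _)
    have := mul_le_mul_of_nonneg_left h3 hc
    linarith
  have hsumi : Integrable (fun ω => ∑ m ∈ Finset.range d, |u m ω ⟨0, hd⟩|) P :=
    integrable_finsetSum _ fun m _ => (hu0i m).abs
  have hnorm : ∫ ω, ‖v ω‖ ∂P
      ≤ d * (1 + L) * ∑ m ∈ Finset.range d, ∫ ω, |u m ω ⟨0, hd⟩| ∂P := by
    rw [← integral_finsetSum _ fun m _ => (hu0i m).abs, ← integral_const_mul]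
    refine integral_mono_of_nonneg (.of_forall fun ω => norm_nonneg _) (hsumi.const_mul _)
      (.of_forall fun ω => ?_)
    exact norm_le_sum_adjoint hd (fun m => u m ω) (fun m => a (i + r - 1 - m))
      (fun m hm => ha _ (by omega)) (fun m => hu_succ m ω)
  calc c * σm * ∫ ω, ‖v ω‖ ∂P
      ≤ c * σm * (d * (1 + L) * ∑ m ∈ Finset.range d, ∫ ω, |u m ω ⟨0, hd⟩| ∂P) := by gcongr
    _ = d * (1 + L) * ∑ m ∈ Finset.range d, c * σm * ∫ ω, |u m ω ⟨0, hd⟩| ∂P := by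
        rw [← Finset.mul_sum]; ring
    _ ≤ d * (1 + L) * ∑ _m ∈ Finset.range d, 2 * ∫ ω, |⟪v ω, X (i + r) ω⟫_ℝ| ∂P := by
        refine mul_le_mul_of_nonneg_left (Finset.sum_le_sum fun m hm => ?_) (by positivity)
        exact hcoord m (Finset.mem_range.1 hm)
    _ = _ := by
        rw [Finset.sum_const, Finset.card_range, nsmul_eq_mul]
        ring

end IsLagProcess

end Innovations

/-! ### The Lyapunov function -/

section Lyapunov

/-- The pointwise inequality behind the decay of the Lyapunov function: the excitation term wins
when the regressor is small, and the drift wins when it is large. -/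
lemma lyapunov_pointwise {B c₁ c₂ μ V y : ℝ} (hB : 1 ≤ B) (hc₁ : 0 < c₁) (hc₂ : 0 < c₂)
    (hμ : 0 ≤ μ) (hμB : 8 * B * μ ≤ 1) (hV : 0 ≤ V) {g a δ T : ℝ}
    (hg : g = c₁ * c₂ ^ 2 / (1 + B)) (ha : a = g / (8 * B)) (hδ : δ = min (1 / 4) (g / 8))
    (hT : T = c₂ / (1 + B) * y / (1 + μ * V)) :
    y ^ 2 + (c₁ * μ ^ 2 * T ^ 2 + a * μ * y ^ 2) * (1 / 2 * V + B) + c₁ * μ * T ^ 2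
      - 2 * c₁ * μ * (c₂ * (T * y)) ≤ (1 - δ * μ) * (y ^ 2 * (1 + a * μ * V)) := by
  have hB0 : 0 < B := by linarith
  have hD : 0 < 1 + μ * V := by positivity
  have hg0 : 0 < g := by rw [hg]; positivity
  have ha0 : 0 < a := by rw [ha]; positivity
  have haB : a * B = g / 8 := by rw [ha]; field_simp
  have hδ1 : δ ≤ 1 / 4 := hδ ▸ min_le_left _ _
  have hδ2 : δ ≤ g / 8 := hδ ▸ min_le_right _ _
  have hδ0 : 0 < δ := by rw [hδ]; positivity
  set Q : ℝ := 1 / (1 + μ * V) with hQ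
  have hQ0 : 0 < Q := by positivity
  have hQD : Q * (1 + μ * V) = 1 := by rw [hQ]; field_simp
  set κ : ℝ := c₂ / (1 + B) with hκ
  have hκB : κ * (1 + B) = c₂ := by rw [hκ]; field_simp
  have hTQ : T = κ * y * Q := by rw [hT, hQ]; ring
  have hμ1 : μ ≤ 1 := by nlinarith
  have h1 : 1 + μ * (1 / 2 * V + B) ≤ (1 + μ * V) * (1 + B) := by
    nlinarith [mul_nonneg hμ hV, mul_nonneg (mul_nonneg hμ hV) hB0.le]
  have h2 : T ^ 2 * (1 + μ * (1 / 2 * V + B)) ≤ κ * c₂ * y ^ 2 * Q := by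
    calc T ^ 2 * (1 + μ * (1 / 2 * V + B)) ≤ T ^ 2 * ((1 + μ * V) * (1 + B)) := by gcongr
      _ = κ * (κ * (1 + B)) * y ^ 2 * Q * (Q * (1 + μ * V)) := by rw [hTQ]; ring
      _ = κ * c₂ * y ^ 2 * Q := by rw [hQD, hκB, mul_one]
  have h3 : c₁ * (κ * c₂) = g := by rw [hg, hκ]; ring
  have h4 : c₁ * μ * (T ^ 2 * (1 + μ * (1 / 2 * V + B))) - 2 * c₁ * μ * (c₂ * (T * y))
      ≤ -(g * μ * y ^ 2 * Q) := by
    have h5 := mul_le_mul_of_nonneg_left h2 (by positivity : 0 ≤ c₁ * μ)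
    have h6 : c₁ * μ * (κ * c₂ * y ^ 2 * Q) = g * μ * y ^ 2 * Q := by rw [← h3]; ring
    have h7 : 2 * c₁ * μ * (c₂ * (T * y)) = 2 * (g * μ * y ^ 2 * Q) := by
      rw [← h3, hTQ]; ring
    linarith
  -- the balance of drift and excitation
  have h5 : -(g * Q) + a * (1 / 2 * V + B) - a * V + δ + δ * (a * (μ * V)) ≤ 0 := by
    have h6 : δ * (a * (μ * V)) ≤ a * V / 4 := by
      have : a * (μ * V) ≤ a * V := by
        have := mul_le_mul_of_nonneg_right hμ1 hV
        have := mul_le_mul_of_nonneg_left this ha0.le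
        linarith
      have h7 : 0 ≤ a * (μ * V) := by positivity
      have h8 := mul_le_mul hδ1 this h7 (by norm_num : (0 : ℝ) ≤ 1 / 4)
      linarith
    rcases le_total V (8 * B) with hVB | hVB
    · have h7 : 1 / 2 ≤ Q := by
        rw [hQ, div_le_div_iff₀ two_pos hD]
        have := mul_le_mul_of_nonneg_left hVB hμ
        linarith
      have h8 := mul_le_mul_of_nonneg_left h7 hg0.le
      have h9 : 0 ≤ a * V := by positivity
      linarith
    · have h8 := mul_le_mul_of_nonneg_left hVB ha0.le
      have h9 : 0 ≤ g * Q := by positivity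
      linarith
  have h6 := mul_le_mul_of_nonneg_left h5 (by positivity : 0 ≤ μ * y ^ 2)
  nlinarith

variable {Ω : Type*} {m : MeasurableSpace Ω} {P : Measure Ω}

lemma measurable_contract {m' : MeasurableSpace Ω} {μ : ℝ} {x w : Ω → Vec d}
    (hx : Measurable[m'] x) (hw : Measurable[m'] w) :
    Measurable[m'] fun ω => contract μ (x ω) (w ω) :=
  hw.sub ((((hx.inner hw).const_mul μ).div ((hx.norm.pow_const 2).const_mul μ |>.const_add 1)).smul
    hx)

lemma measurable_weight {m' : MeasurableSpace Ω} {x w : Ω → Vec d}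
    (hx : Measurable[m'] x) (hw : Measurable[m'] w) (κ μ : ℝ) :
    Measurable[m'] fun ω => κ * ‖w ω‖ / (1 + μ * ‖x ω‖ ^ 2) := by
  fun_prop

lemma measurable_combined_weight {m' : MeasurableSpace Ω} {T : Ω → ℝ} {w : Ω → Vec d}
    (hT : Measurable[m'] T) (hw : Measurable[m'] w) (κ μ : ℝ) :
    Measurable[m'] fun ω => κ * T ω ^ 2 + μ * ‖w ω‖ ^ 2 := by
  fun_prop

variable [IsProbabilityMeasure P]

set_option maxHeartbeats 400000 in
/-- Geometric decay over one block of the Lyapunov function `|w|² (1 + a μ |X|²)`, where `w`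
is contracted along the regressors `X`. The weight `T` linearizes the excitation,
`ξ² / (1 + μ |X|²) ≥ 2 T |ξ| - T² (1 + μ |X|²)`, so that only first absolute moments of `ξ` and
second moments of `X` enter. -/
lemma integral_lyapunov_le {𝓕 : Filtration ℕ m} {B c₂ μ g a δ : ℝ} {r i : ℕ}
    (hr : 1 ≤ r) (hB : 1 ≤ B) (hc₂ : 0 < c₂) (hμ : 0 ≤ μ) (hμB : 8 * B * μ ≤ 1)
    (hg : g = (2 ^ r)⁻¹ * c₂ ^ 2 / (1 + B)) (ha : a = g / (8 * B)) (hδ : δ = min (1 / 4) (g / 8))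
    {X w : ℕ → Ω → Vec d} (hX : Measurable[𝓕 i] (X i)) (hXr : Measurable (X (i + r)))
    (hXi2 : Integrable (fun ω => ‖X i ω‖ ^ 2) P)
    (hXr2 : Integrable (fun ω => ‖X (i + r) ω‖ ^ 2) P)
    (hdrift : ∀ τ : Ω → ℝ, Measurable[𝓕 i] τ → (∀ ω, 0 ≤ τ ω) → (∃ C, ∀ ω, τ ω ≤ C) →
      ∫ ω, τ ω * ‖X (i + r) ω‖ ^ 2 ∂P ≤ ∫ ω, τ ω * (1 / 2 * ‖X i ω‖ ^ 2 + B) ∂P)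
    (hexc : ∀ v : Ω → Vec d, Measurable[𝓕 i] v → (∃ b, ∀ ω, ‖v ω‖ ≤ b) →
      c₂ * ∫ ω, ‖v ω‖ ∂P ≤ ∫ ω, |⟪v ω, X (i + r) ω⟫_ℝ| ∂P)
    (hw : Measurable[𝓕 i] (w i)) (hwr : Measurable (w (i + r))) (hw1 : ∀ ω, ‖w i ω‖ ≤ 1)
    (hstep : ∀ s < r, ∀ ω, w (i + s + 1) ω = contract μ (X (i + s + 1) ω) (w (i + s) ω)) :
    ∫ ω, ‖w (i + r) ω‖ ^ 2 * (1 + a * μ * ‖X (i + r) ω‖ ^ 2) ∂P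
      ≤ (1 - δ * μ) * ∫ ω, ‖w i ω‖ ^ 2 * (1 + a * μ * ‖X i ω‖ ^ 2) ∂P := by
  have hB0 : 0 < B := by linarith
  set c₁ : ℝ := (2 ^ r)⁻¹ with hc₁
  have hc₁0 : 0 < c₁ := by positivity
  have hg0 : 0 < g := by rw [hg]; positivity
  have ha0 : 0 < a := by rw [ha]; positivity
  set T : Ω → ℝ := fun ω => c₂ / (1 + B) * ‖w i ω‖ / (1 + μ * ‖X i ω‖ ^ 2) with hT
  have hT0 : ∀ ω, 0 ≤ T ω := fun ω => by simp only [hT]; positivity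
  have hTm : Measurable[𝓕 i] T := measurable_weight hX hw _ _
  have hTC : ∀ ω, T ω ≤ c₂ := by
    intro ω
    have h1 : (1 : ℝ) ≤ 1 + μ * ‖X i ω‖ ^ 2 := by
      have : 0 ≤ μ * ‖X i ω‖ ^ 2 := by positivity
      linarith
    have h2 : c₂ / (1 + B) ≤ c₂ := div_le_self hc₂.le (by linarith)
    calc T ω ≤ c₂ / (1 + B) * ‖w i ω‖ := div_le_self (by positivity) h1
      _ ≤ c₂ * 1 := by gcongr; exact hw1 ω
      _ = c₂ := mul_one _
  set v : Ω → Vec d := fun ω => T ω • w i ω with hv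
  have hvm : Measurable[𝓕 i] v := hTm.smul hw
  have hvn : ∀ ω, ‖v ω‖ = T ω * ‖w i ω‖ := fun ω => by
    rw [hv, norm_smul, Real.norm_of_nonneg (hT0 ω)]
  have hvb : ∀ ω, ‖v ω‖ ≤ c₂ := fun ω => by
    rw [hvn]
    calc T ω * ‖w i ω‖ ≤ c₂ * 1 := by gcongr; exacts [hTC ω, hw1 ω]
      _ = c₂ := mul_one _
  set τ : Ω → ℝ := fun ω => c₁ * μ ^ 2 * T ω ^ 2 + a * μ * ‖w i ω‖ ^ 2 with hτ
  have hτm : Measurable[𝓕 i] τ := measurable_combined_weight hTm hw _ _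
  have hτ0 : ∀ ω, 0 ≤ τ ω := fun ω => by simp only [hτ]; positivity
  have hτC : ∀ ω, τ ω ≤ c₁ * μ ^ 2 * c₂ ^ 2 + a * μ * 1 ^ 2 := fun ω => by
    simp only [hτ]
    gcongr
    exacts [hTC ω, hw1 ω]
  have hτC' : ∀ ω, |τ ω| ≤ c₁ * μ ^ 2 * c₂ ^ 2 + a * μ * 1 ^ 2 := fun ω => by
    rw [abs_of_nonneg (hτ0 ω)]; exact hτC ω
  have hτm' := hτm.mono (𝓕.le i) le_rfl
  have hwm' := hw.mono (𝓕.le i) le_rfl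
  have hwr1 : ∀ ω, ‖w (i + r) ω‖ ≤ ‖w i ω‖ := by
    have : ∀ s ≤ r, ∀ ω, ‖w (i + s) ω‖ ≤ ‖w i ω‖ := by
      intro s
      induction s with
      | zero => intro _ ω; exact le_rfl
      | succ s ih =>
        intro hs ω
        rw [← add_assoc, hstep s hs]
        exact (norm_contract_le hμ _ _).trans (ih (by omega) ω)
    exact this r le_rfl
  -- the energy balance over the block, for each outcome
  have hpt : ∀ ω, ‖w (i + r) ω‖ ^ 2 * (1 + a * μ * ‖X (i + r) ω‖ ^ 2)
        + 2 * c₁ * μ * |⟪v ω, X (i + r) ω⟫_ℝ|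
      ≤ (‖w i ω‖ ^ 2 + c₁ * μ * T ω ^ 2) + τ ω * ‖X (i + r) ω‖ ^ 2 := by
    intro ω
    have h1 := excitation_le hμ (fun s => X (i + s) ω) (fun s => w (i + s) ω) (r - 1)
      (fun s hs => hstep s (by omega) ω)
    simp only [Nat.sub_add_cancel hr, add_zero] at h1
    set ξ : ℝ := ⟪X (i + r) ω, w i ω⟫_ℝ with hξ
    set V' : ℝ := ‖X (i + r) ω‖ ^ 2 with hV'
    have hV'0 : 0 ≤ V' := by positivity
    have hD : 0 < 1 + μ * V' := by positivity
    have h2 : 2 * T ω * |ξ| - T ω ^ 2 * (1 + μ * V') ≤ ξ ^ 2 / (1 + μ * V') := by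
      rw [le_div_iff₀ hD, ← sq_abs ξ]
      nlinarith [sq_nonneg (|ξ| - T ω * (1 + μ * V'))]
    have h3 : |⟪v ω, X (i + r) ω⟫_ℝ| = T ω * |ξ| := by
      rw [hv, real_inner_smul_left, abs_mul, abs_of_nonneg (hT0 ω), real_inner_comm]
    have h4 : c₁ * (μ * ξ ^ 2 / (1 + μ * V')) ≤ ‖w i ω‖ ^ 2 - ‖w (i + r) ω‖ ^ 2 := by
      rw [hc₁, inv_mul_le_iff₀ (by positivity)]
      exact h1
    have h5 := mul_le_mul_of_nonneg_left h2 (by positivity : 0 ≤ c₁ * μ)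
    have h6 : c₁ * μ * (ξ ^ 2 / (1 + μ * V')) = c₁ * (μ * ξ ^ 2 / (1 + μ * V')) := by ring
    have h7 := pow_le_pow_left₀ (norm_nonneg _) (hwr1 ω) 2
    have h8 := mul_le_mul_of_nonneg_left h7 (by positivity : 0 ≤ a * μ * V')
    rw [h3]
    simp only [hτ]
    linarith
  -- integrability of the terms
  have hWi : Integrable (fun ω => ‖w i ω‖ ^ 2) P :=
    Integrable.of_bound (hwm'.norm.pow_const 2).aestronglyMeasurable 1 (.of_forall fun ω => by
      rw [Real.norm_of_nonneg (by positivity)]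
      exact pow_le_one₀ (norm_nonneg _) (hw1 ω))
  have hTi : Integrable (fun ω => T ω ^ 2) P :=
    Integrable.of_bound ((hTm.mono (𝓕.le i) le_rfl).pow_const 2).aestronglyMeasurable (c₂ ^ 2)
      (.of_forall fun ω => by
        rw [Real.norm_of_nonneg (by positivity)]
        exact pow_le_pow_left₀ (hT0 ω) (hTC ω) 2)
  have hvi : Integrable (fun ω => ‖v ω‖) P :=
    Integrable.of_bound (hvm.mono (𝓕.le i) le_rfl).norm.aestronglyMeasurable c₂
      (.of_forall fun ω => by rw [norm_norm]; exact hvb ω)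
  have hLi : ∀ {x u : Ω → Vec d}, Measurable u → (∀ ω, ‖u ω‖ ≤ 1) →
      Integrable (fun ω => ‖x ω‖ ^ 2) P →
      Integrable (fun ω => ‖u ω‖ ^ 2 * (1 + a * μ * ‖x ω‖ ^ 2)) P := fun hu hu1 hx =>
    integrable_mul_of_bounded (hu.norm.pow_const 2) (b := 1)
      (fun ω => by
        rw [abs_of_nonneg (by positivity)]
        exact pow_le_one₀ (norm_nonneg _) (hu1 ω)) ((integrable_const _).add (hx.const_mul _))
  have hLr := hLi hwr (fun ω => (hwr1 ω).trans (hw1 ω)) hXr2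
  have hLi' := hLi hwm' hw1 hXi2
  have hξi : Integrable (fun ω => |⟪v ω, X (i + r) ω⟫_ℝ|) P := by
    refine Integrable.mono' (((integrable_const (1 : ℝ)).add hXr2).const_mul c₂)
      ((hvm.mono (𝓕.le i) le_rfl).inner hXr).abs.aestronglyMeasurable (.of_forall fun ω => ?_)
    rw [Real.norm_eq_abs, abs_abs]
    refine (abs_real_inner_le_norm _ _).trans (mul_le_mul (hvb ω) ?_ (norm_nonneg _) hc₂.le)
    simp only [Pi.add_apply]
    nlinarith [sq_nonneg (‖X (i + r) ω‖ - 1)]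
  have hτXr : Integrable (fun ω => τ ω * ‖X (i + r) ω‖ ^ 2) P :=
    integrable_mul_of_bounded hτm' hτC' hXr2
  have hτXi : Integrable (fun ω => τ ω * (1 / 2 * ‖X i ω‖ ^ 2 + B)) P :=
    integrable_mul_of_bounded hτm' hτC' ((hXi2.const_mul _).add (integrable_const _))
  have hWT : Integrable (fun ω => ‖w i ω‖ ^ 2 + c₁ * μ * T ω ^ 2) P :=
    hWi.add (hTi.const_mul (c₁ * μ))
  have hWTτ : Integrable (fun ω => ‖w i ω‖ ^ 2 + c₁ * μ * T ω ^ 2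
      + τ ω * (1 / 2 * ‖X i ω‖ ^ 2 + B)) P := hWT.add hτXi
  have h1 := integral_mono (hLr.add (hξi.const_mul (2 * c₁ * μ)))
    (hWT.add hτXr) hpt
  simp only [Pi.add_apply] at h1
  rw [integral_add hLr (hξi.const_mul _), integral_const_mul, integral_add hWT hτXr] at h1
  have h2 := hdrift τ hτm hτ0 ⟨_, hτC⟩
  have h3 := mul_le_mul_of_nonneg_left (hexc v hvm ⟨_, hvb⟩) (by positivity : 0 ≤ 2 * c₁ * μ)
  have h4 : ∫ ω, (((‖w i ω‖ ^ 2 + c₁ * μ * T ω ^ 2) + τ ω * (1 / 2 * ‖X i ω‖ ^ 2 + B))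
      - 2 * c₁ * μ * c₂ * ‖v ω‖) ∂P
      ≤ ∫ ω, (1 - δ * μ) * (‖w i ω‖ ^ 2 * (1 + a * μ * ‖X i ω‖ ^ 2)) ∂P := by
    refine integral_mono (hWTτ.sub (hvi.const_mul _))
      (hLi'.const_mul _) fun ω => ?_
    have := lyapunov_pointwise hB hc₁0 hc₂ hμ hμB (sq_nonneg ‖X i ω‖) hg ha hδ
      (rfl : T ω = c₂ / (1 + B) * ‖w i ω‖ / (1 + μ * ‖X i ω‖ ^ 2))
    simp only [hvn, hτ]
    linarith
  rw [integral_sub hWTτ (hvi.const_mul _),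
    integral_add hWT hτXi, integral_const_mul,
    integral_const_mul] at h4
  linarith

end Lyapunov

/-! ### Moments -/

section Moments

variable {Ω : Type*} {m : MeasurableSpace Ω} {P : Measure Ω} [IsProbabilityMeasure P]

lemma integral_norm_pow_le_of_eLpNorm_le {E : Type*} [NormedAddCommGroup E] {f : Ω → E}
    (hf : AEStronglyMeasurable f P) {k : ℕ} (hk : k ≠ 0) {q S : ℝ} (hkq : k ≤ q) (hS : 0 ≤ S)
    (h : eLpNorm f (ENNReal.ofReal q) P ≤ ENNReal.ofReal S) :
    MemLp f k P ∧ ∫ ω, ‖f ω‖ ^ k ∂P ≤ S ^ k := by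
  have hle : eLpNorm f k P ≤ ENNReal.ofReal S := by
    refine (eLpNorm_le_eLpNorm_of_exponent_le ?_ hf).trans h
    rw [← ENNReal.ofReal_natCast]
    exact ENNReal.ofReal_le_ofReal hkq
  have hmem : MemLp f k P := ⟨hf, hle.trans_lt ENNReal.ofReal_lt_top⟩
  refine ⟨hmem, ?_⟩
  rw [hmem.eLpNorm_eq_integral_rpow_norm (by exact_mod_cast hk) (by simp),
    ENNReal.ofReal_le_ofReal_iff hS] at hle
  simp only [ENNReal.toReal_natCast, Real.rpow_natCast] at hle
  have hI : 0 ≤ ∫ ω, ‖f ω‖ ^ k ∂P := integral_nonneg fun ω => by positivity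
  calc ∫ ω, ‖f ω‖ ^ k ∂P = ((∫ ω, ‖f ω‖ ^ k ∂P) ^ (k : ℝ)⁻¹) ^ k :=
        (Real.rpow_inv_natCast_pow hI hk).symm
    _ ≤ S ^ k := by gcongr

/-- A bound on the fourth moment of a standardized variable keeps its first absolute moment away
from zero. -/
lemma le_integral_abs_of_fourth_moment {f : Ω → ℝ} (hf : MemLp f 4 P) {S : ℝ}
    (h2 : ∫ ω, f ω ^ 2 ∂P = 1) (h4 : ∫ ω, f ω ^ 4 ∂P ≤ S ^ 4) :
    1 / (2 * (2 * S ^ 4 + 1)) ≤ ∫ ω, |f ω| ∂P := by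
  set K : ℝ := 2 * S ^ 4 + 1 with hK
  have hS4 : 0 ≤ S ^ 4 := by positivity
  have hK1 : 1 ≤ K := by rw [hK]; linarith
  have hK0 : 0 < K := by linarith
  have hi1 : Integrable (fun ω => |f ω|) P := (hf.integrable (by norm_num)).abs
  have hi2 : Integrable (fun ω => f ω ^ 2) P :=
    (hf.mono_exponent (by norm_num : (2 : ENNReal) ≤ 4)).integrable_sq
  have hi4 : Integrable (fun ω => f ω ^ 4) P := by
    have := MemLp.integrable_norm_pow (p := 4) (by exact_mod_cast hf) (by norm_num)
    simpa [Even.pow_abs (by decide : Even 4)] using this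
  -- truncation at level `K`, which is so large that the tail carries at most half of `E f² = 1`
  have hpt : ∀ ω, f ω ^ 2 ≤ K * |f ω| + (1 / K ^ 2) * f ω ^ 4 := by
    intro ω
    have e2 : f ω ^ 2 = |f ω| ^ 2 := (sq_abs _).symm
    have e4 : f ω ^ 4 = |f ω| ^ 4 := by rw [Even.pow_abs (by decide : Even 4)]
    rw [e2, e4]
    set y := |f ω|
    have hy : 0 ≤ y := abs_nonneg _
    rcases le_total y K with h | h
    · have : 0 ≤ 1 / K ^ 2 * y ^ 4 := by positivity
      nlinarith
    · have h1 : K ^ 2 * y ^ 2 ≤ y ^ 4 := by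
        have := mul_le_mul_of_nonneg_right (pow_le_pow_left₀ hK0.le h 2) (sq_nonneg y)
        nlinarith
      have h2 : y ^ 2 ≤ 1 / K ^ 2 * y ^ 4 := by
        rw [one_div, ← div_eq_inv_mul, le_div_iff₀ (by positivity)]
        linarith
      have : 0 ≤ K * y := by positivity
      linarith
  have h := integral_mono hi2 ((hi1.const_mul K).add (hi4.const_mul (1 / K ^ 2))) hpt
  simp only [Pi.add_apply] at h
  rw [integral_add (hi1.const_mul K) (hi4.const_mul (1 / K ^ 2)), integral_const_mul,
    integral_const_mul, h2] at h
  have h5 : 1 / K ^ 2 * ∫ ω, f ω ^ 4 ∂P ≤ 1 / 2 := by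
    rw [one_div, ← div_eq_inv_mul, div_le_div_iff₀ (by positivity) two_pos]
    nlinarith
  rw [div_le_iff₀ (by positivity)]
  linarith

/-- Interpolation for functions with values in `[0, 1]`: the second moment controls all others. -/
lemma eLpNorm_le_of_integral_sq_le {G : Ω → ℝ} (hG : Measurable G) (hG0 : ∀ ω, 0 ≤ G ω)
    (hG1 : ∀ ω, G ω ≤ 1) {b p p' : ℝ} (hb : ∫ ω, G ω ^ 2 ∂P ≤ b) (hpp' : p ≤ p') (hp' : 2 ≤ p') :
    eLpNorm G (ENNReal.ofReal p) P ≤ ENNReal.ofReal (b ^ p'⁻¹) := by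
  have hmem : ∀ r : ENNReal, MemLp G r P := fun r =>
    MemLp.of_bound hG.aestronglyMeasurable 1 (.of_forall fun ω => by
      rw [Real.norm_of_nonneg (hG0 ω)]; exact hG1 ω)
  refine (eLpNorm_le_eLpNorm_of_exponent_le (ENNReal.ofReal_le_ofReal hpp')
    hG.aestronglyMeasurable).trans ?_
  rw [(hmem _).eLpNorm_eq_integral_rpow_norm (by simp; linarith) ENNReal.ofReal_ne_top,
    ENNReal.toReal_ofReal (by linarith)]
  refine ENNReal.ofReal_le_ofReal (Real.rpow_le_rpow
    (integral_nonneg fun ω => by positivity) (le_trans ?_ hb) (by positivity))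
  refine integral_mono_of_nonneg (.of_forall fun ω => by positivity) (hmem 2).integrable_sq
    (.of_forall fun ω => ?_)
  simp only
  rw [Real.norm_of_nonneg (hG0 ω), ← Real.rpow_natCast (G ω) 2]
  exact Real.rpow_le_rpow_of_exponent_ge' (hG0 ω) (hG1 ω) (by norm_num) (by exact_mod_cast hp')

end Moments

/-! ### The filtration of the past -/

section Past

variable {Ω : Type*} {m : MeasurableSpace Ω} {P : Measure Ω} [IsProbabilityMeasure P]

lemma indepFun_prodMk_left {α β γ : Type*} [MeasurableSpace α] [MeasurableSpace β]
    [MeasurableSpace γ] {X : Ω → α} {Y : Ω → β} {Z : Ω → γ} (hX : Measurable X)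
    (hY : Measurable Y) (hZ : Measurable Z) (h : IndepFun X (fun ω => (Y ω, Z ω)) P)
    (h' : IndepFun Y Z P) : IndepFun (fun ω => (X ω, Y ω)) Z P := by
  have hXY : IndepFun X Y P := h.comp measurable_id measurable_fst
  have := Measure.isProbabilityMeasure_map (μ := P) hX.aemeasurable
  have := Measure.isProbabilityMeasure_map (μ := P) hY.aemeasurable
  have := Measure.isProbabilityMeasure_map (μ := P) hZ.aemeasurable
  rw [indepFun_iff_map_prod_eq_prod_map_map (hX.prodMk hY).aemeasurable hZ.aemeasurable,
    hXY.map_prod_eq_prod_map_map hX.aemeasurable hY.aemeasurable]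
  have h1 := h.map_prod_eq_prod_map_map hX.aemeasurable (hY.prodMk hZ).aemeasurable
  rw [h'.map_prod_eq_prod_map_map hY.aemeasurable hZ.aemeasurable, ← Measure.prodAssoc_prod] at h1
  have h2 : P.map (fun ω => ((X ω, Y ω), Z ω))
      = (P.map fun ω => (X ω, (Y ω, Z ω))).map MeasurableEquiv.prodAssoc.symm := by
    rw [Measure.map_map (MeasurableEquiv.measurable _) (hX.prodMk (hY.prodMk hZ))]
    rfl
  rw [h2, h1, Measure.map_map (MeasurableEquiv.measurable _) (MeasurableEquiv.measurable _)]
  simp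

/-- The σ-algebras generated by the initial vector and the innovations up to a given time. -/
def pastFiltration {n : ℕ} {X₀ : Ω → Vec d} {ε : ℕ → Ω → ℝ} (hX₀ : Measurable X₀)
    (hε : ∀ k ∈ Set.Icc 1 n, Measurable (ε k)) : Filtration ℕ m where
  seq l := MeasurableSpace.comap X₀ inferInstance
    ⊔ ⨆ k ∈ Set.Icc 1 (min l n), MeasurableSpace.comap (ε k) inferInstance
  mono' _ _ hl := sup_le_sup_left (biSup_mono fun _ hk =>
    ⟨hk.1, hk.2.trans (min_le_min_right n hl)⟩) _
  le' _ := sup_le hX₀.comap_le (iSup₂_le fun k hk =>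
    (hε k ⟨hk.1, hk.2.trans (min_le_right _ _)⟩).comap_le)

lemma indep_pastFiltration {n : ℕ} {X₀ : Ω → Vec d} {ε : ℕ → Ω → ℝ} (hX₀ : Measurable X₀)
    (hε : ∀ k ∈ Set.Icc 1 n, Measurable (ε k)) (hind : iIndepFun (fun k : Set.Icc 1 n => ε k) P)
    (hind₀ : IndepFun (fun ω => fun k : Set.Icc 1 n => ε k ω) X₀ P) {l : ℕ} (hl : l < n) :
    Indep (pastFiltration hX₀ hε l) (MeasurableSpace.comap (ε (l + 1)) inferInstance) P := by
  set S : Finset (Set.Icc 1 n) := Finset.univ.filter fun k => k.1 ≤ l with hS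
  set k₀ : Set.Icc 1 n := ⟨l + 1, by omega, hl⟩ with hk₀
  set Y : Ω → (S → ℝ) := fun ω k => ε k.1 ω with hY
  have hεk : ∀ k : Set.Icc 1 n, Measurable (ε k) := fun k => hε k k.2
  have hYm : Measurable Y := measurable_pi_lambda _ fun k => hεk k.1
  have hYZ : IndepFun Y (ε (l + 1)) P := by
    have hdis : Disjoint S {k₀} := by
      rw [Finset.disjoint_singleton_right, hS, Finset.mem_filter]
      simp [hk₀]
    have := hind.indepFun_finset S {k₀} hdis hεk
    exact this.comp (φ := id) (ψ := fun f : (({k₀} : Finset (Set.Icc 1 n)) → ℝ) =>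
      f ⟨k₀, Finset.mem_singleton_self _⟩) measurable_id (measurable_pi_apply _)
  have hXYZ : IndepFun X₀ (fun ω => (Y ω, ε (l + 1) ω)) P := by
    refine hind₀.symm.comp (φ := id)
      (ψ := fun e : (Set.Icc 1 n → ℝ) => ((fun k : S => e k.1), e k₀)) measurable_id ?_
    exact (measurable_pi_lambda _ fun k => measurable_pi_apply _).prodMk (measurable_pi_apply _)
  have hmain := indepFun_prodMk_left hX₀ hYm (hε (l + 1) k₀.2) hXYZ hYZ
  refine indep_of_indep_of_le_left hmain (sup_le ?_ (iSup₂_le fun k hk => ?_))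
  · rw [← measurable_iff_comap_le]
    exact measurable_fst.comp (comap_measurable (fun ω => (X₀ ω, Y ω)))
  · have hkn : k ∈ Set.Icc 1 n := ⟨hk.1, hk.2.trans (min_le_right _ _)⟩
    have hkS : (⟨k, hkn⟩ : Set.Icc 1 n) ∈ S := by
      rw [hS, Finset.mem_filter]
      exact ⟨Finset.mem_univ _, hk.2.trans (min_le_left _ _)⟩
    rw [← measurable_iff_comap_le]
    have h1 : Measurable fun p : Vec d × (S → ℝ) => p.2 ⟨⟨k, hkn⟩, hkS⟩ :=
      (measurable_pi_apply _).comp measurable_snd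
    exact h1.comp (comap_measurable (fun ω => (X₀ ω, Y ω)))

/-- Under moment bounds of order `q ≥ 4`, the row is driven by innovations whose first absolute
moments are bounded below in terms of the bound `S` only. -/
lemma isInnovation_pastFiltration {n : ℕ} {X₀ : Ω → Vec d} {ε : ℕ → Ω → ℝ} {q S : ℝ}
    (hX₀ : Measurable X₀) (hε : ∀ k ∈ Set.Icc 1 n, Measurable (ε k))
    (hind : iIndepFun (fun k : Set.Icc 1 n => ε k) P)
    (hind₀ : IndepFun (fun ω => fun k : Set.Icc 1 n => ε k ω) X₀ P)
    (hmean : ∀ k ∈ Set.Icc 1 n, ∫ ω, ε k ω ∂P = 0)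
    (hvar : ∀ k ∈ Set.Icc 1 n, variance (ε k) P = 1) (hq : 4 ≤ q) (hS : 0 ≤ S)
    (hεS : ∀ k ∈ Set.Icc 1 n, eLpNorm (ε k) (ENNReal.ofReal q) P ≤ ENNReal.ofReal S) :
    IsInnovation P (pastFiltration hX₀ hε) ε n (1 / (2 * (2 * S ^ 4 + 1))) := by
  have hmem : ∀ l < n, l + 1 ∈ Set.Icc 1 n := fun l hl => ⟨by omega, hl⟩
  have hsq : ∀ k ∈ Set.Icc 1 n, ∫ ω, ε k ω ^ 2 ∂P = 1 := fun k hk => by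
    rw [← variance_of_integral_eq_zero (hε k hk).aemeasurable (hmean k hk), hvar k hk]
  have h4 : ∀ k ∈ Set.Icc 1 n, MemLp (ε k) 4 P ∧ ∫ ω, ‖ε k ω‖ ^ 4 ∂P ≤ S ^ 4 := fun k hk =>
    integral_norm_pow_le_of_eLpNorm_le (hε k hk).aestronglyMeasurable (by norm_num)
      (by exact_mod_cast hq) hS (hεS k hk)
  refine ⟨fun l hl => ?_, fun l hl => indep_pastFiltration hX₀ hε hind hind₀ hl,
    fun l hl => (h4 _ (hmem l hl)).1.mono_exponent (by norm_num),
    fun l hl => hmean _ (hmem l hl), fun l hl => hsq _ (hmem l hl), fun l hl => ?_⟩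
  · rw [measurable_iff_comap_le]
    refine le_sup_of_le_right (le_iSup₂_of_le (l + 1) ⟨by omega, ?_⟩ le_rfl)
    exact le_min le_rfl hl
  · obtain ⟨h5, h6⟩ := h4 _ (hmem l hl)
    refine le_integral_abs_of_fourth_moment h5 (hsq _ (hmem l hl)) ?_
    simpa [Even.pow_abs (by decide : Even 4)] using h6

end Past

/-! ### Decay of the products -/

/-- Uniform bound for the second moments of the lag vectors, when the initial second moment is at
most `D₀`, the companion maps are bounded by `K`, the scales by `b`, and the flow contracts over
`r` steps. -/
noncomputable def secondMomentBound (K b D₀ : ℝ) (r : ℕ) : ℝ :=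
  2 * (1 + K) ^ (2 * r) * D₀ + 4 * ∑ t ∈ Finset.range (r + 1), noiseBound K b t

lemma secondMomentBound_nonneg {K b D₀ : ℝ} (hK : 0 ≤ K) (hD₀ : 0 ≤ D₀) (r : ℕ) :
    0 ≤ secondMomentBound K b D₀ r := by
  have : 0 ≤ ∑ t ∈ Finset.range (r + 1), noiseBound K b t :=
    Finset.sum_nonneg fun t _ => noiseBound_nonneg K b t
  rw [secondMomentBound]
  positivity

section Row

variable {Ω : Type*} {m : MeasurableSpace Ω} {P : Measure Ω} {𝓕 : Filtration ℕ m}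
  {ε : ℕ → Ω → ℝ} {n : ℕ} {c : ℝ} {a : ℕ → Vec d} {s : ℕ → ℝ} {X : ℕ → Ω → Vec d}

lemma measurable_prodVec (hX : IsLagProcess P 𝓕 ε n a s X) (hε : IsInnovation P 𝓕 ε n c) (μ : ℝ)
    {j k : ℕ} (hjk : j ≤ k) (hk : k ≤ n) (u : Vec d) :
    Measurable[𝓕 k] fun ω => prodVec μ (fun l => X l ω) j u k := by
  induction k, hjk using Nat.le_induction with
  | base =>
    simp only [prodVec_self]
    exact measurable_const
  | succ k hjk ih =>
    simp only [prodVec_succ μ _ hjk]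
    exact measurable_contract (hX.adapted hε hk)
      ((ih (by omega)).mono (𝓕.mono (Nat.le_succ k)) le_rfl)

variable [IsProbabilityMeasure P]

lemma IsLagProcess.integral_norm_sq_le (hX : IsLagProcess P 𝓕 ε n a s X)
    (hε : IsInnovation P 𝓕 ε n c) {K b D₀ : ℝ} (hK : 0 ≤ K)
    (ha : ∀ l < n, ∀ x, ‖companion (a l) x‖ ≤ K * ‖x‖) (hs : ∀ l < n, |s l| ≤ b) {r : ℕ}
    (hr : 1 ≤ r) (hflow : ∀ i, i + r ≤ n → ∀ x, ‖flow a i r x‖ ≤ 1 / 2 * ‖x‖)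
    (h0 : ∫ ω, ‖X 0 ω‖ ^ 2 ∂P ≤ D₀) {j : ℕ} (hj : j ≤ n) :
    ∫ ω, ‖X j ω‖ ^ 2 ∂P ≤ secondMomentBound K b D₀ r := by
  have hD₀ : 0 ≤ D₀ := (integral_nonneg fun ω => by positivity).trans h0
  have hsingle : ∀ t ≤ r, noiseBound K b t ≤ ∑ t ∈ Finset.range (r + 1), noiseBound K b t :=
    fun t ht => Finset.single_le_sum (f := noiseBound K b) (fun t _ => noiseBound_nonneg K b t)
      (Finset.mem_range.2 (by omega))
  have hone : ∀ {q : ℝ} {i t : ℕ}, i + t ≤ n → (∀ x, ‖flow a i t x‖ ≤ q * ‖x‖) →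
      ∫ ω, ‖X (i + t) ω‖ ^ 2 ∂P
        ≤ 2 * q ^ 2 * ∫ ω, ‖X i ω‖ ^ 2 ∂P + 2 * noiseBound K b t := by
    intro q i t hit hq
    have := hX.integral_mul_norm_sq_le hε ha hs hit hq (τ := fun _ => 1) measurable_const
      (fun _ => zero_le_one) (C := 1) (fun _ => le_rfl)
    simp only [one_mul] at this
    rwa [integral_add ((hX.integrable_norm_sq hε (by omega)).const_mul _) (integrable_const _),
      integral_const_mul, integral_const, probReal_univ, one_smul] at this
  induction j using Nat.strong_induction_on with
  | _ j ih =>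
    rcases lt_or_ge j r with hjr | hjr
    · have h1 := hone (q := K ^ j) (i := 0) (t := j) (by omega)
        fun x => norm_flow_le hK (fun l hl => ha _ (by omega)) x
      rw [zero_add] at h1
      have h2 : (K ^ j) ^ 2 ≤ (1 + K) ^ (2 * r) := by
        rw [← pow_mul]
        calc K ^ (j * 2) ≤ (1 + K) ^ (j * 2) := by gcongr; linarith
          _ ≤ (1 + K) ^ (2 * r) := pow_le_pow_right₀ (by linarith) (by omega)
      have h3 : 2 * (K ^ j) ^ 2 * ∫ ω, ‖X 0 ω‖ ^ 2 ∂P ≤ 2 * (1 + K) ^ (2 * r) * D₀ := by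
        gcongr
      have h4 := hsingle j hjr.le
      have h5 := noiseBound_nonneg K b j
      rw [secondMomentBound]
      linarith
    · have h1 := hone (i := j - r) (t := r) (by omega) (hflow _ (by omega))
      rw [Nat.sub_add_cancel hjr] at h1
      have h2 := ih (j - r) (by omega) (by omega)
      have h3 := hsingle r le_rfl
      have h4 : 0 ≤ 2 * (1 + K) ^ (2 * r) * D₀ := by positivity
      rw [secondMomentBound] at h2 ⊢
      norm_num at h1
      linarith

/-- Geometric decay of the second moments of the contracted vectors, along blocks of length
`r`. -/
lemma integral_prodVec_le (hd : 1 ≤ d) (hX : IsLagProcess P 𝓕 ε n a s X)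
    (hε : IsInnovation P 𝓕 ε n c) {L σm σp D₀ : ℝ} (hc : 0 < c) (hL : 0 ≤ L)
    (ha : ∀ l < n, ‖a l‖ ≤ L) (hσm : 0 < σm) (hs : ∀ l < n, s l ∈ Set.Icc σm σp) {r : ℕ}
    (hr : d ≤ r) (hflow : ∀ i, i + r ≤ n → ∀ x, ‖flow a i r x‖ ≤ 1 / 2 * ‖x‖)
    (h0 : ∫ ω, ‖X 0 ω‖ ^ 2 ∂P ≤ D₀) {K B c₂ g e δ μ : ℝ} (hK : K = d * (1 + L))
    (hB : B = 1 + 2 * noiseBound K σp r) (hc₂ : c₂ = c * σm / (2 * d ^ 2 * (1 + L)))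
    (hg : g = (2 ^ r)⁻¹ * c₂ ^ 2 / (1 + B)) (he : e = g / (8 * B)) (hδ : δ = min (1 / 4) (g / 8))
    (hμ : 0 ≤ μ) (hμB : 8 * B * μ ≤ 1) {j k : ℕ} (hjk : j ≤ k) (hk : k ≤ n) {u : Vec d}
    (hu : ‖u‖ ≤ 1) :
    ∫ ω, ‖prodVec μ (fun l => X l ω) j u k‖ ^ 2 ∂P
      ≤ (1 + e * secondMomentBound K σp D₀ r) * (1 - δ * μ) ^ ((k - j) / r) := by
  have hd0 : (0 : ℝ) < d := by exact_mod_cast hd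
  have hN := noiseBound_nonneg K σp r
  have hB1 : 1 ≤ B := by rw [hB]; linarith
  have hc₂0 : 0 < c₂ := by rw [hc₂]; positivity
  have hg0 : 0 < g := by rw [hg]; positivity
  have he0 : 0 < e := by rw [he]; positivity
  have hμ1 : μ ≤ 1 := by nlinarith
  have hδ1 : δ ≤ 1 / 4 := hδ ▸ min_le_left _ _
  have hδ0 : 0 < δ := by rw [hδ]; positivity
  have hδμ : 0 ≤ 1 - δ * μ := by nlinarith
  have hK0 : 0 ≤ K := by rw [hK]; positivity
  have haK : ∀ l < n, ∀ x, ‖companion (a l) x‖ ≤ K * ‖x‖ := fun l hl x => by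
    refine (norm_companion_le _ _).trans ?_
    rw [hK]
    have := ha l hl
    gcongr
  have hsb : ∀ l < n, |s l| ≤ σp := fun l hl => by
    rw [abs_of_nonneg (hσm.le.trans (hs l hl).1)]
    exact (hs l hl).2
  have hr1 : 1 ≤ r := hd.trans hr
  set w : ℕ → Ω → Vec d := fun l ω => prodVec μ (fun l => X l ω) j u l with hw
  have hwm : ∀ l, j ≤ l → l ≤ n → Measurable[𝓕 l] (w l) := fun l hjl hl =>
    measurable_prodVec hX hε μ hjl hl u
  have hw1 : ∀ l, j ≤ l → ∀ ω, ‖w l ω‖ ≤ 1 := fun l hjl ω => (norm_prodVec_le hμ _ hjl u).trans hu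
  set φ : ℕ → ℝ := fun l => ∫ ω, ‖w l ω‖ ^ 2 * (1 + e * μ * ‖X l ω‖ ^ 2) ∂P with hφ
  have hblock : ∀ i, j ≤ i → i + r ≤ n → φ (i + r) ≤ (1 - δ * μ) * φ i := by
    intro i hji hir
    refine integral_lyapunov_le (𝓕 := 𝓕) hr1 hB1 hc₂0 hμ hμB hg he hδ (hX.adapted hε (by omega))
      (hX.measurable hε hir) (hX.integrable_norm_sq hε (by omega))
      (hX.integrable_norm_sq hε hir) ?_ ?_ (hwm i hji (by omega))
      ((hwm _ (by omega) hir).mono (𝓕.le _) le_rfl) (hw1 i hji)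
      (fun t ht ω => prodVec_succ μ _ (by omega) u)
    · rintro τ hτ hτ0 ⟨C, hC⟩
      refine (hX.integral_mul_norm_sq_le hε haK hsb hir (hflow i hir) hτ hτ0 hC).trans ?_
      have hτC : ∀ ω, |τ ω| ≤ C := fun ω => by rw [abs_of_nonneg (hτ0 ω)]; exact hC ω
      have hV := (hX.integrable_norm_sq hε (by omega : i ≤ n))
      have hτm := hτ.mono (𝓕.le _) le_rfl
      refine integral_mono
        (integrable_mul_of_bounded hτm hτC ((hV.const_mul _).add (integrable_const _)))
        (integrable_mul_of_bounded hτm hτC ((hV.const_mul _).add (integrable_const _)))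
        fun ω => mul_le_mul_of_nonneg_left ?_ (hτ0 ω)
      simp only
      rw [hB]
      linarith
    · rintro v hv ⟨b, hb⟩
      have := hX.integral_norm_le_integral_inner hd hε hc.le ha (fun l hl => (hs l hl).1) hσm.le hr
        hir hv hb
      rw [hc₂, div_mul_eq_mul_div, div_le_iff₀ (by positivity)]
      linarith
  have hiter : ∀ M, j + M * r ≤ n → φ (j + M * r) ≤ (1 - δ * μ) ^ M * φ j := by
    intro M
    induction M with
    | zero => intro _; simp
    | succ M ih =>
      intro hM
      have hM' : j + M * r + r ≤ n := by rw [add_mul, one_mul] at hM; omega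
      have h1 := hblock (j + M * r) (by omega) hM'
      have h2 := mul_le_mul_of_nonneg_left (ih (by omega)) hδμ
      rw [show j + (M + 1) * r = j + M * r + r by ring, pow_succ']
      linarith
  have hφi : ∀ l, j ≤ l → l ≤ n →
      Integrable (fun ω => ‖w l ω‖ ^ 2 * (1 + e * μ * ‖X l ω‖ ^ 2)) P := fun l hjl hl =>
    integrable_mul_of_bounded (((hwm l hjl hl).mono (𝓕.le _) le_rfl).norm.pow_const 2) (b := 1)
      (fun ω => by
        rw [abs_of_nonneg (by positivity)]
        exact pow_le_one₀ (norm_nonneg _) (hw1 l hjl ω))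
      ((integrable_const _).add ((hX.integrable_norm_sq hε hl).const_mul _))
  have hφj : φ j ≤ 1 + e * secondMomentBound K σp D₀ r := by
    have hV := hX.integrable_norm_sq hε (hjk.trans hk)
    have h1 := hX.integral_norm_sq_le hε hK0 haK hsb hr1 hflow h0 (hjk.trans hk)
    have h2 : 0 ≤ ∫ ω, ‖X j ω‖ ^ 2 ∂P := integral_nonneg fun ω => by positivity
    calc φ j ≤ ∫ ω, (1 + e * ‖X j ω‖ ^ 2) ∂P := by
          refine integral_mono (hφi j le_rfl (hjk.trans hk))
            ((integrable_const _).add (hV.const_mul _)) fun ω => ?_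
          simp only
          have h3 : ‖w j ω‖ ^ 2 ≤ 1 := pow_le_one₀ (norm_nonneg _) (hw1 j le_rfl ω)
          calc _ ≤ 1 * (1 + e * 1 * ‖X j ω‖ ^ 2) := by gcongr
            _ = _ := by ring
      _ = 1 + e * ∫ ω, ‖X j ω‖ ^ 2 ∂P := by
          rw [integral_add (integrable_const _) (hV.const_mul _), integral_const_mul,
            integral_const, probReal_univ, one_smul]
      _ ≤ _ := by gcongr
  set M := (k - j) / r with hM
  have hMk : j + M * r ≤ k := by
    have : M * r ≤ k - j := Nat.div_mul_le_self (k - j) r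
    omega
  calc ∫ ω, ‖w k ω‖ ^ 2 ∂P ≤ φ (j + M * r) := by
        refine integral_mono_of_nonneg (.of_forall fun ω => by positivity)
          (hφi _ (by omega) (by omega)) (.of_forall fun ω => ?_)
        have h1 : ‖w k ω‖ ^ 2 ≤ ‖w (j + M * r) ω‖ ^ 2 := by
          gcongr
          exact norm_prodVec_le_of_le hμ _ (by omega) hMk u
        have h2 : 0 ≤ ‖w (j + M * r) ω‖ ^ 2 * (e * μ * ‖X (j + M * r) ω‖ ^ 2) := by positivity
        simp only
        linarith
    _ ≤ (1 - δ * μ) ^ M * φ j := hiter M (hMk.trans hk)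
    _ ≤ (1 - δ * μ) ^ M * (1 + e * secondMomentBound K σp D₀ r) := by gcongr
    _ = _ := mul_comm _ _

end Row

/-- From a decay by blocks of length `r` for the moment of order `p'` to the rate per step for the
norm, by Bernoulli's inequality. -/
lemma rpow_block_decay_le {C δ μ p' : ℝ} (hC : 1 ≤ C) (hδ : 0 ≤ δ) (hδ1 : δ ≤ 1 / 4)
    (hμ : 0 ≤ μ) (hμ1 : μ ≤ 1) (hp' : 1 ≤ p') {r : ℕ} (hr : 1 ≤ r) (e : ℕ) :
    (C * (1 - δ * μ) ^ (e / r)) ^ p'⁻¹ ≤ C * 2 ^ r * (1 - δ / (r * p') * μ) ^ e := by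
  have hr0 : (1 : ℝ) ≤ r := by exact_mod_cast hr
  have hrp : 1 ≤ r * p' := by nlinarith
  set y := 1 - δ / (r * p') * μ with hy
  have hδμ : δ * μ ≤ 1 / 4 := by nlinarith
  have hδμ0 : 0 ≤ δ * μ := by positivity
  have hx0 : 0 ≤ 1 - δ * μ := by linarith
  have hy2 : 1 / 2 ≤ y := by
    have : δ / (r * p') * μ ≤ δ * μ := by gcongr; exact div_le_self hδ hrp
    rw [hy]; linarith
  have hy0 : 0 ≤ y := by linarith
  have hbern : 1 - δ * μ ≤ y ^ ((r : ℝ) * p') := by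
    have := one_add_mul_self_le_rpow_one_add (s := y - 1) (by linarith) hrp
    rw [show 1 + (r * p') * (y - 1) = 1 - δ * μ by rw [hy]; field_simp; ring,
      add_sub_cancel] at this
    exact this
  have h1 : (1 - δ * μ) ^ p'⁻¹ ≤ y ^ r := by
    calc (1 - δ * μ) ^ p'⁻¹ ≤ (y ^ ((r : ℝ) * p')) ^ p'⁻¹ := by gcongr
      _ = y ^ r := by
          rw [← Real.rpow_mul hy0, mul_assoc, mul_inv_cancel₀ (by linarith), mul_one,
            Real.rpow_natCast]
  have h2 : C ^ p'⁻¹ ≤ C := by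
    calc C ^ p'⁻¹ ≤ C ^ (1 : ℝ) := Real.rpow_le_rpow_of_exponent_le hC (inv_le_one_of_one_le₀ hp')
      _ = C := Real.rpow_one C
  have h3 : (y ^ r) ^ (e / r) ≤ 2 ^ r * y ^ e := by
    have hy1 : y ≤ 1 := by
      have : 0 ≤ δ / (r * p') * μ := by positivity
      rw [hy]; linarith
    have h4 : 1 ≤ 2 ^ r * y ^ (e % r) := by
      have h5 : (1 : ℝ) ≤ (2 * y) ^ (e % r) := one_le_pow₀ (by linarith)
      have h6 : (2 : ℝ) ^ (e % r) ≤ 2 ^ r :=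
        pow_le_pow_right₀ (by norm_num) (Nat.mod_lt _ hr).le
      rw [mul_pow] at h5
      exact h5.trans (by gcongr)
    calc (y ^ r) ^ (e / r) = 1 * y ^ (r * (e / r)) := by rw [← pow_mul, one_mul]
      _ ≤ (2 ^ r * y ^ (e % r)) * y ^ (r * (e / r)) := by gcongr
      _ = 2 ^ r * y ^ e := by rw [mul_assoc, ← pow_add, Nat.mod_add_div]
  rw [Real.mul_rpow (by linarith) (by positivity)]
  calc C ^ p'⁻¹ * ((1 - δ * μ) ^ (e / r)) ^ p'⁻¹
      = C ^ p'⁻¹ * ((1 - δ * μ) ^ p'⁻¹) ^ (e / r) := by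
        rw [← Real.rpow_natCast, ← Real.rpow_natCast, ← Real.rpow_mul hx0, ← Real.rpow_mul hx0,
          mul_comm p'⁻¹]
    _ ≤ C * (y ^ r) ^ (e / r) := by gcongr
    _ ≤ C * (2 ^ r * y ^ e) := by gcongr
    _ = _ := by ring

end TVAR

theorem theorem15 {d : ℕ} (hd : 1 ≤ d) {Ω : ℕ → Type*} [∀ n, MeasurableSpace (Ω n)]
    (P : ∀ n, Measure (Ω n)) [∀ n, IsProbabilityMeasure (P n)]
    (X₀ : ∀ n, Ω n → TVAR.Vec d) (ε : ∀ n, ℕ → Ω n → ℝ)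
    (q : ℝ) (hq : 4 ≤ q) (hA1 : TVAR.A1 P X₀ ε q)
    (β L ρ σm σp : ℝ) (hβ : β ∈ Set.Ioc (0 : ℝ) 1) (hL : 0 < L) (hρ : ρ ∈ Set.Ioo (0 : ℝ) 1)
    (hσm : 0 < σm) (hσ : σm ≤ σp) (p : ℝ) (hp : 1 ≤ p) :
    ∃ M δ μ₀ : ℝ, 0 < M ∧ 0 < δ ∧ 0 < μ₀ ∧
      ∀ n j k : ℕ, 1 ≤ n → j ≤ k → k ≤ n → ∀ μ ∈ Set.Icc 0 μ₀,
        ∀ θ : ℝ → TVAR.Vec d, ∀ σ : ℝ → ℝ, (θ, σ) ∈ TVAR.ParamClass d β L ρ σm σp →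
          eLpNorm (TVAR.Psi n θ σ (X₀ n) (ε n) k j μ) (ENNReal.ofReal p) (P n)
            ≤ ENNReal.ofReal (M * (1 - δ * μ) ^ (k - j)) := by
  open TVAR in
  obtain ⟨r, N₀, hdr, hflow⟩ := exists_flow_contraction hd hβ.1 hL hρ
  have hr1 : 1 ≤ r := hd.trans hdr
  have hd0 : (0 : ℝ) < d := by exact_mod_cast hd
  have hd1 : (1 : ℝ) ≤ d := by exact_mod_cast hd
  -- moment bounds for the rows
  set S₀ : ℝ := (⨆ n : ℕ, ⨆ _ : 1 ≤ n, eLpNorm (X₀ n) (ENNReal.ofReal q) (P n)).toReal with hS₀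
  set S : ℝ := (⨆ n : ℕ, ⨆ k : ℕ, ⨆ _ : k ∈ Set.Icc 1 n,
    eLpNorm (ε n k) (ENNReal.ofReal q) (P n)).toReal with hS
  have hX₀S : ∀ n, 1 ≤ n → eLpNorm (X₀ n) (ENNReal.ofReal q) (P n) ≤ ENNReal.ofReal S₀ := by
    intro n hn
    rw [hS₀, ENNReal.ofReal_toReal hA1.init_bound.ne]
    exact le_iSup₂ (f := fun (n : ℕ) (_ : 1 ≤ n) => eLpNorm (X₀ n) (ENNReal.ofReal q) (P n)) n hn
  have hεS : ∀ n, ∀ k ∈ Set.Icc 1 n,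
      eLpNorm (ε n k) (ENNReal.ofReal q) (P n) ≤ ENNReal.ofReal S := by
    intro n k hk
    rw [hS, ENNReal.ofReal_toReal hA1.innov_bound.ne]
    exact (le_iSup₂ (f := fun (k : ℕ) (_ : k ∈ Set.Icc 1 n) =>
      eLpNorm (ε n k) (ENNReal.ofReal q) (P n)) k hk).trans (le_iSup (fun n : ℕ =>
        ⨆ k : ℕ, ⨆ _ : k ∈ Set.Icc 1 n, eLpNorm (ε n k) (ENNReal.ofReal q) (P n)) n)
  -- the constants
  set c : ℝ := 1 / (2 * (2 * S ^ 4 + 1)) with hc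
  have hc0 : 0 < c := by positivity
  set K : ℝ := d * (1 + L) with hK
  set B : ℝ := 1 + 2 * noiseBound K σp r with hB
  have hB1 : 1 ≤ B := by
    have := noiseBound_nonneg K σp r
    rw [hB]; linarith
  set c₂ : ℝ := c * σm / (2 * d ^ 2 * (1 + L)) with hc₂
  have hc₂0 : 0 < c₂ := by positivity
  set g : ℝ := (2 ^ r)⁻¹ * c₂ ^ 2 / (1 + B) with hg
  have hg0 : 0 < g := by positivity
  set e : ℝ := g / (8 * B) with he
  set δ : ℝ := min (1 / 4) (g / 8) with hδ
  have hδ0 : 0 < δ := by positivity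
  have hδ1 : δ ≤ 1 / 4 := min_le_left _ _
  set D : ℝ := secondMomentBound K σp (S₀ ^ 2) r with hD
  have hD0 : 0 ≤ D := secondMomentBound_nonneg (by positivity) (by positivity) r
  set C : ℝ := d * (d * (1 + e * D)) with hC
  have hC1 : 1 ≤ C := by
    have h1 : 1 ≤ 1 + e * D := by
      have : 0 ≤ e * D := by positivity
      linarith
    have h2 : 1 ≤ d * (1 + e * D) := by nlinarith
    rw [hC]; nlinarith
  set p' : ℝ := max p 2 with hp'
  have hp'2 : 2 ≤ p' := le_max_right _ _
  have hrp : 1 ≤ r * p' := by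
    have : (1 : ℝ) ≤ r := by exact_mod_cast hr1
    nlinarith
  refine ⟨C * 2 ^ r * 2 ^ N₀, δ / (r * p'), 1 / (8 * B), by positivity, by positivity,
    by positivity, fun n j k hn hjk hkn μ hμ θ σ hθσ => ?_⟩
  obtain ⟨hμ0, hμ1⟩ := hμ
  have hμB : 8 * B * μ ≤ 1 := by
    have := mul_le_mul_of_nonneg_left hμ1 (by positivity : 0 ≤ 8 * B)
    rwa [mul_one_div_cancel (by positivity)] at this
  have hμ1' : μ ≤ 1 := by nlinarith
  have hn0 : (0 : ℝ) < n := by exact_mod_cast hn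
  have hmem : ∀ l : ℕ, l ≤ n → (l : ℝ) / n ∈ Set.Icc (0 : ℝ) 1 := fun l hl =>
    ⟨by positivity, (div_le_one hn0).2 (by exact_mod_cast hl)⟩
  set x : Ω n → ℕ → Vec d := fun ω => lagVec n θ σ (X₀ n ω) fun i => ε n i ω with hx
  have hΨ1 : ∀ ω, ‖Psi n θ σ (X₀ n) (ε n) k j μ ω‖ ≤ 1 := fun ω =>
    norm_matProd_le_one hμ0 (x ω) hjk
  have hy2 : 1 / 2 ≤ 1 - δ / (r * p') * μ := by
    have h1 : δ / (r * p') * μ ≤ δ * 1 :=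
      mul_le_mul (div_le_self hδ0.le hrp) hμ1' hμ0 hδ0.le
    linarith
  rcases lt_or_ge n N₀ with hnN | hnN
  · -- few factors, each of norm at most one
    refine (eLpNorm_le_of_ae_bound (.of_forall hΨ1)).trans ?_
    simp only [measure_univ, ENNReal.one_rpow, one_mul]
    refine ENNReal.ofReal_le_ofReal ?_
    have h1 : (1 : ℝ) ≤ (2 * (1 - δ / (r * p') * μ)) ^ (k - j) := one_le_pow₀ (by linarith)
    have h2 : (2 : ℝ) ^ (k - j) ≤ 2 ^ N₀ := pow_le_pow_right₀ (by norm_num) (by omega)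
    have h3 : (1 : ℝ) ≤ C * 2 ^ r := one_le_mul_of_one_le_of_one_le hC1 (one_le_pow₀ (by norm_num))
    rw [mul_pow] at h1
    calc (1 : ℝ) ≤ 1 * (2 ^ (k - j) * (1 - δ / (r * p') * μ) ^ (k - j)) := by rwa [one_mul]
      _ ≤ (C * 2 ^ r) * (2 ^ N₀ * (1 - δ / (r * p') * μ) ^ (k - j)) := by
          have : 0 ≤ (1 - δ / (r * p') * μ) ^ (k - j) := pow_nonneg (by linarith) _
          gcongr
      _ = _ := by ring
  · have hX₀m := hA1.measurable_init n hn
    have hεm := hA1.measurable_innov n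
    have hinn := isInnovation_pastFiltration hX₀m hεm (hA1.indep n hn) (hA1.indep_init n hn)
      (hA1.mean_zero n) (hA1.unit_variance n) hq ENNReal.toReal_nonneg (hεS n)
    obtain ⟨hX₀2, hX₀D⟩ := integral_norm_pow_le_of_eLpNorm_le hX₀m.aestronglyMeasurable
      two_ne_zero (by norm_num; linarith) ENNReal.toReal_nonneg (hX₀S n hn)
    have hlag : IsLagProcess (P n) (pastFiltration hX₀m hεm) (ε n) n
        (fun l => θ ((l : ℝ) / n)) (fun l => σ (((l + 1 : ℕ) : ℝ) / n)) (fun l ω => x ω l) :=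
      ⟨measurable_iff_comap_le.2 le_sup_left,
        hX₀2.integrable_norm_pow two_ne_zero,
        fun l _ ω => lagVec_succ n θ σ (X₀ n ω) (fun i => ε n i ω) l⟩
    have hdecay : ∀ i, ∫ ω, ‖prodVec μ (x ω) j (EuclideanSpace.single i (1 : ℝ)) k‖ ^ 2 ∂(P n)
        ≤ (1 + e * D) * (1 - δ * μ) ^ ((k - j) / r) := fun i =>
      integral_prodVec_le hd hlag hinn hc0 hL.le (fun l hl => hθσ.1.1.2 _ (hmem l hl.le)) hσm
        (fun l hl => hθσ.2 _ (hmem (l + 1) hl)) hdr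
        (fun i hi => hflow n hnN θ hθσ.1 i hi) hX₀D hK hB hc₂ hg he hδ hμ0 hμB hjk hkn
        (by simp)
    have hwm : ∀ i, Measurable
        fun ω => prodVec μ (x ω) j (EuclideanSpace.single i (1 : ℝ)) k := fun i =>
      (measurable_prodVec hlag hinn μ hjk hkn _).mono ((pastFiltration hX₀m hεm).le _) le_rfl
    have hwi : ∀ i, Integrable
        (fun ω => ‖prodVec μ (x ω) j (EuclideanSpace.single i (1 : ℝ)) k‖ ^ 2) (P n) := fun i =>
      Integrable.of_bound ((hwm i).norm.pow_const 2).aestronglyMeasurable 1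
        (.of_forall fun ω => by
          rw [Real.norm_of_nonneg (by positivity)]
          exact pow_le_one₀ (norm_nonneg _) ((norm_prodVec_le hμ0 _ hjk _).trans (by simp)))
    -- a measurable majorant of the operator norm
    set R : Ω n → ℝ := fun ω =>
      d * ∑ i, ‖prodVec μ (x ω) j (EuclideanSpace.single i (1 : ℝ)) k‖ ^ 2 with hR
    have hRm : Measurable R :=
      (Finset.measurable_sum _ fun i _ => (hwm i).norm.pow_const 2).const_mul _
    have hR0 : ∀ ω, 0 ≤ R ω := fun ω => by simp only [hR]; positivity
    have hRi : Integrable R (P n) := (integrable_finsetSum _ fun i _ => hwi i).const_mul _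
    set G : Ω n → ℝ := fun ω => min 1 (√(R ω)) with hG
    have hGm : Measurable G := measurable_const.min hRm.sqrt
    have hG0 : ∀ ω, 0 ≤ G ω := fun ω => le_min zero_le_one (Real.sqrt_nonneg _)
    have hΨG : ∀ ω, ‖Psi n θ σ (X₀ n) (ε n) k j μ ω‖ ≤ G ω := fun ω =>
      le_min (hΨ1 ω) (Real.le_sqrt_of_sq_le (norm_matProd_sq_le μ (x ω) j k))
    have hG2 : ∫ ω, G ω ^ 2 ∂(P n) ≤ C * (1 - δ * μ) ^ ((k - j) / r) := by
      calc ∫ ω, G ω ^ 2 ∂(P n) ≤ ∫ ω, R ω ∂(P n) := by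
            refine integral_mono_of_nonneg (.of_forall fun ω => by positivity) hRi
              (.of_forall fun ω => ?_)
            calc G ω ^ 2 ≤ √(R ω) ^ 2 := by
                  gcongr
                  exact min_le_right _ _
              _ = R ω := Real.sq_sqrt (hR0 ω)
        _ = d * ∑ i, ∫ ω, ‖prodVec μ (x ω) j (EuclideanSpace.single i (1 : ℝ)) k‖ ^ 2 ∂(P n) := by
            rw [hR, integral_const_mul, integral_finsetSum _ fun i _ => hwi i]
        _ ≤ d * ∑ _i : Fin d, (1 + e * D) * (1 - δ * μ) ^ ((k - j) / r) := by
            gcongr with i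
            exact hdecay i
        _ = _ := by
            simp only [Finset.sum_const, Finset.card_univ, Fintype.card_fin, nsmul_eq_mul, hC]
            ring
    refine (eLpNorm_mono_real hΨG).trans ((eLpNorm_le_of_integral_sq_le hGm hG0
      (fun ω => min_le_left _ _) hG2 (le_max_left p 2) hp'2).trans (ENNReal.ofReal_le_ofReal ?_))
    refine (rpow_block_decay_le hC1 hδ0.le hδ1 hμ0 hμ1' (by linarith) hr1 (k - j)).trans ?_
    have h1 : (1 : ℝ) ≤ 2 ^ N₀ := one_le_pow₀ (by norm_num)
    have h2 : 0 ≤ (1 - δ / (r * p') * μ) ^ (k - j) := pow_nonneg (by linarith) _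
    refine mul_le_mul_of_nonneg_right ?_ h2
    exact le_mul_of_one_le_right (by positivity) h1
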